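/- All rings are associative with unit. A ring $A$ is *Gorenstein* if it is left and right noetherian and has finite injective dimension both as a left and as a right module over itself; a Gorenstein ring $A$ is *$m$-Gorenstein* ($m\ge 0$) if both of these injective dimensions are at most $m$. A ring is *quasi-Frobenius* if it is left and right noetherian and injective both as a left and as a right module over itself (equivalently, $0$-Gorenstein). Let $n\ge 2$. Let $R_1,\dots,R_n$ be rings, let $M_{ij}$ be an $R_i$-$R_j$-bimodule for $1\le i<j\le n$, and let $\psi_{ilj}\colon M_{il}\otimes_{R_l}M_{lj}\to M_{ij}$ be bimodule morphisms for $1\le i<l<j\le n$ satisfying $$\psi_{ijt}(\psi_{ilj}(a\otimes b)\otimes c)=\psi_{ilt}(a\otimes\psi_{ljt}(b\otimes c))\qquad (a\in M_{il},\ b\in M_{lj},\ c\in M_{jt})$$ for $1\le i<l<j<t\le n$. Let $\Gamma$ be the corresponding upper triangular matrix ring: its elements are the upper triangular matrices $(m_{ij})_{1\le i\le j\le n}$ with $m_{ii}\in R_i$ and $m_{ij}\in M_{ij}$ for $i<j$, added entrywise and multiplied by matrix multiplication, where products of entries are given by the ring multiplications, the bimodule actions and the maps $\psi_{ilj}$.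 For $1\le t\le n-1$ let $\Gamma_t$ be the ring given by the leading principal $t\times t$ submatrix of $\Gamma$, and let $M_t^*$ be the left $\Gamma_t$-module of column vectors with entries in $M_{1,t+1},\dots,M_{t,t+1}$, on which $\Gamma_t$ acts by matrix multiplication. Assume that $R_1,\dots,R_n$ are quasi-Frobenius. Then: 1. $\Gamma$ is Gorenstein if and only if, for all $1\le i<j\le n$, the bimodule $M_{ij}$ is finitely generated projective both as a left $R_i$-module and as a right $R_j$-module. 2. $\Gamma$ is $1$-Gorenstein if and only if, for all $1\le i<j\le n$, the bimodule $M_{ij}$ is finitely generated projective both as a left $R_i$-module and as a right $R_j$-module, and, for all $1\le t\le n-1$, the left $\Gamma_t$-module $M_t^*$ is projective. -/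

import Mathlib

open CategoryTheory MulOpposite

universe u v

/-- A ring is quasi-Frobenius if it is left and right noetherian and left and right
self-injective. Right `A`-modules are modules over `Aᵐᵒᵖ`. -/
structure IsQuasiFrobenius (A : Type u) [Ring A] : Prop where
  noetherian_left : IsNoetherian A A
  noetherian_right : IsNoetherian Aᵐᵒᵖ A
  injective_left : Module.Injective A A
  injective_right : Module.Injective Aᵐᵒᵖ A

/-- A ring is Gorenstein if it is left and right noetherian and has finite injective dimension
both as a left and as a right module over itself. -/
structure IsGorenstein (A : Type u) [Ring A] : Prop where
  noetherian_left : IsNoetherian A A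
  noetherian_right : IsNoetherian Aᵐᵒᵖ A
  injectiveDimension_left : injectiveDimension (ModuleCat.of A A) ≠ ⊤
  injectiveDimension_right : injectiveDimension (ModuleCat.of Aᵐᵒᵖ A) ≠ ⊤

/-- A Gorenstein ring is `m`-Gorenstein if its left and right self-injective dimensions
are at most `m`. -/
structure IsMGorenstein (m : ℕ) (A : Type u) [Ring A] : Prop extends IsGorenstein A where
  injectiveDimension_left_le : injectiveDimension (ModuleCat.of A A) ≤ m
  injectiveDimension_right_le : injectiveDimension (ModuleCat.of Aᵐᵒᵖ A) ≤ m

/-- The data of an upper triangular matrix ring of order `n`: rings `R i`, an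
`R i`-`R j`-bimodule `M i j` for all `i < j` (the right action is an action of `(R j)ᵐᵒᵖ`), and
bimodule morphisms `M i l ⊗ M l j → M i j` over `R l` for all `i < l < j`, associative for all
`i < l < j < t`. A bimodule morphism out of the tensor product over the (not necessarily
commutative) ring `R l` is given as a biadditive, `R l`-balanced map `ψ` which is left
`R i`-linear and right `R j`-linear. Indices run over `0, …, n - 1`. -/
structure TriangularData (n : ℕ) where
  R : Fin n → Type u
  M : (i j : Fin n) → i < j → Type v
  [ring : ∀ i, Ring (R i)]
  [addCommGroup : ∀ i j h, AddCommGroup (M i j h)]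
  [moduleLeft : ∀ i j h, Module (R i) (M i j h)]
  [moduleRight : ∀ i j h, Module (R j)ᵐᵒᵖ (M i j h)]
  [smulCommClass : ∀ i j h, SMulCommClass (R i) (R j)ᵐᵒᵖ (M i j h)]
  ψ : ∀ {i l j : Fin n} (hil : i < l) (hlj : l < j),
    M i l hil →+ M l j hlj →+ M i j (hil.trans hlj)
  ψ_smul_left : ∀ {i l j : Fin n} (hil : i < l) (hlj : l < j) (r : R i)
    (a : M i l hil) (b : M l j hlj), ψ hil hlj (r • a) b = r • ψ hil hlj a b
  ψ_balanced : ∀ {i l j : Fin n} (hil : i < l) (hlj : l < j) (r : R l)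
    (a : M i l hil) (b : M l j hlj), ψ hil hlj (op r • a) b = ψ hil hlj a (r • b)
  ψ_smul_right : ∀ {i l j : Fin n} (hil : i < l) (hlj : l < j) (r : R j)
    (a : M i l hil) (b : M l j hlj), ψ hil hlj a (op r • b) = op r • ψ hil hlj a b
  ψ_assoc : ∀ {i l j t : Fin n} (hil : i < l) (hlj : l < j) (hjt : j < t)
    (a : M i l hil) (b : M l j hlj) (c : M j t hjt),
    ψ (hil.trans hlj) hjt (ψ hil hlj a b) c = ψ hil (hlj.trans hjt) a (ψ hlj hjt b c)

namespace TriangularData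

attribute [instance] ring addCommGroup moduleLeft moduleRight smulCommClass

/-- The data of the leading principal `t × t` submatrix. -/
def leading {n : ℕ} (D : TriangularData.{u, v} n) (t : ℕ) (ht : t ≤ n) :
    TriangularData.{u, v} t where
  R i := D.R (Fin.castLE ht i)
  M i j h := D.M (Fin.castLE ht i) (Fin.castLE ht j) h
  ψ hil hlj := D.ψ (i := Fin.castLE ht _) (l := Fin.castLE ht _) (j := Fin.castLE ht _) hil hlj
  ψ_smul_left _ _ := D.ψ_smul_left _ _
  ψ_balanced _ _ := D.ψ_balanced _ _
  ψ_smul_right _ _ := D.ψ_smul_right _ _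
  ψ_assoc _ _ _ := D.ψ_assoc _ _ _

/-- The upper triangular matrix ring: an element consists of its diagonal entries in the `R i`
and of its entries in `M i j` for `i < j`. -/
@[ext]
structure MatrixRing {n : ℕ} (D : TriangularData.{u, v} n) : Type (max u v) where
  diag : ∀ i, D.R i
  off : ∀ i j (h : i < j), D.M i j h

namespace MatrixRing

variable {n : ℕ} {D : TriangularData.{u, v} n}

instance : Zero D.MatrixRing := ⟨⟨fun _ => 0, fun _ _ _ => 0⟩⟩

instance : One D.MatrixRing := ⟨⟨fun _ => 1, fun _ _ _ => 0⟩⟩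

instance : Add D.MatrixRing :=
  ⟨fun x y => ⟨fun i => x.diag i + y.diag i, fun i j h => x.off i j h + y.off i j h⟩⟩

instance : Neg D.MatrixRing :=
  ⟨fun x => ⟨fun i => -x.diag i, fun i j h => -x.off i j h⟩⟩

/-- Matrix multiplication: for `i < j`, the sum over `i ≤ l ≤ j` of the products of the
`(i, l)`-entry and the `(l, j)`-entry, with the terms `l = i` and `l = j` written separately. -/
instance : Mul D.MatrixRing :=
  ⟨fun x y => ⟨fun i => x.diag i * y.diag i, fun i j h =>
    x.diag i • y.off i j h + op (y.diag j) • x.off i j h +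
      ∑ l, if hl : i < l ∧ l < j then D.ψ hl.1 hl.2 (x.off i l hl.1) (y.off l j hl.2) else 0⟩⟩

@[simp] theorem zero_diag (i : Fin n) : (0 : D.MatrixRing).diag i = 0 := rfl
@[simp] theorem zero_off (i j : Fin n) (h : i < j) : (0 : D.MatrixRing).off i j h = 0 := rfl
@[simp] theorem one_diag (i : Fin n) : (1 : D.MatrixRing).diag i = 1 := rfl
@[simp] theorem one_off (i j : Fin n) (h : i < j) : (1 : D.MatrixRing).off i j h = 0 := rfl
@[simp] theorem add_diag (x y : D.MatrixRing) (i : Fin n) :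
    (x + y).diag i = x.diag i + y.diag i := rfl
@[simp] theorem add_off (x y : D.MatrixRing) (i j : Fin n) (h : i < j) :
    (x + y).off i j h = x.off i j h + y.off i j h := rfl
@[simp] theorem neg_diag (x : D.MatrixRing) (i : Fin n) : (-x).diag i = -x.diag i := rfl
@[simp] theorem neg_off (x : D.MatrixRing) (i j : Fin n) (h : i < j) :
    (-x).off i j h = -x.off i j h := rfl
@[simp] theorem mul_diag (x y : D.MatrixRing) (i : Fin n) :
    (x * y).diag i = x.diag i * y.diag i := rfl
theorem mul_off (x y : D.MatrixRing) (i j : Fin n) (h : i < j) :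
    (x * y).off i j h = x.diag i • y.off i j h + op (y.diag j) • x.off i j h +
      ∑ l, if hl : i < l ∧ l < j then D.ψ hl.1 hl.2 (x.off i l hl.1) (y.off l j hl.2) else 0 :=
  rfl

theorem sum_assoc {i j : Fin n} (h : i < j) (x y z : D.MatrixRing) :
    (∑ l, if hl : i < l ∧ l < j then D.ψ hl.1 hl.2
      (∑ k, if hk : i < k ∧ k < l then D.ψ hk.1 hk.2 (x.off i k hk.1) (y.off k l hk.2) else 0)
      (z.off l j hl.2) else 0 : D.M i j h) =
    ∑ k, if hk : i < k ∧ k < j then D.ψ hk.1 hk.2 (x.off i k hk.1)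
      (∑ l, if hl : k < l ∧ l < j then D.ψ hl.1 hl.2 (y.off k l hl.1) (z.off l j hl.2) else 0)
      else 0 := by
  trans ∑ l, ∑ k, if hl : (i < k ∧ k < l) ∧ l < j then
    D.ψ (hl.1.1.trans hl.1.2) hl.2
      (D.ψ hl.1.1 hl.1.2 (x.off i k hl.1.1) (y.off k l hl.1.2)) (z.off l j hl.2) else 0
  · refine Finset.sum_congr rfl fun l _ => ?_
    split_ifs with hl
    · rw [map_sum, AddMonoidHom.finsetSum_apply]
      refine Finset.sum_congr rfl fun k _ => ?_
      by_cases hk : i < k ∧ k < l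
      · rw [dif_pos hk, dif_pos ⟨hk, hl.2⟩]
      · rw [dif_neg hk, dif_neg fun hh => hk hh.1]
        simp
    · refine (Finset.sum_eq_zero fun k _ => dif_neg ?_).symm
      exact fun hh => hl ⟨hh.1.1.trans hh.1.2, hh.2⟩
  · rw [Finset.sum_comm]
    refine Finset.sum_congr rfl fun k _ => ?_
    split_ifs with hk
    · rw [map_sum]
      refine Finset.sum_congr rfl fun l _ => ?_
      by_cases hl : k < l ∧ l < j
      · rw [dif_pos hl, dif_pos ⟨⟨hk.1, hl.1⟩, hl.2⟩, D.ψ_assoc]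
      · rw [dif_neg hl, dif_neg fun hh => hl ⟨hh.1.2, hh.2⟩]
        simp
    · refine Finset.sum_eq_zero fun l _ => dif_neg ?_
      exact fun hh => hk ⟨hh.1.1, hh.1.2.trans hh.2⟩

instance : Ring D.MatrixRing where
  add_assoc _ _ _ := by ext <;> simp [add_assoc]
  zero_add _ := by ext <;> simp
  add_zero _ := by ext <;> simp
  add_comm _ _ := by ext <;> simp [add_comm]
  neg_add_cancel _ := by ext <;> simp
  zero_mul _ := by
    ext i j h
    · simp
    · rw [mul_off, Finset.sum_eq_zero fun l _ => by split_ifs <;> simp]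
      simp
  mul_zero _ := by
    ext i j h
    · simp
    · rw [mul_off, Finset.sum_eq_zero fun l _ => by split_ifs <;> simp]
      simp
  one_mul _ := by
    ext i j h
    · simp
    · rw [mul_off, Finset.sum_eq_zero fun l _ => by split_ifs <;> simp]
      simp
  mul_one _ := by
    ext i j h
    · simp
    · rw [mul_off, Finset.sum_eq_zero fun l _ => by split_ifs <;> simp]
      simp
  left_distrib x y z := by
    ext i j h
    · simp [mul_add]
    · have : ∀ l, (if hl : i < l ∧ l < j then
          D.ψ hl.1 hl.2 (x.off i l hl.1) ((y + z).off l j hl.2) else 0 : D.M i j h) =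
          (if hl : i < l ∧ l < j then D.ψ hl.1 hl.2 (x.off i l hl.1) (y.off l j hl.2) else 0) +
          (if hl : i < l ∧ l < j then D.ψ hl.1 hl.2 (x.off i l hl.1) (z.off l j hl.2) else 0) := by
        intro l
        split_ifs <;> simp
      simp only [mul_off, add_off, add_diag, MulOpposite.op_add, smul_add, add_smul] at this ⊢
      rw [Finset.sum_congr rfl fun l _ => this l, Finset.sum_add_distrib]
      abel
  right_distrib x y z := by
    ext i j h
    · simp [add_mul]
    · have : ∀ l, (if hl : i < l ∧ l < j then
          D.ψ hl.1 hl.2 ((x + y).off i l hl.1) (z.off l j hl.2) else 0 : D.M i j h) =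
          (if hl : i < l ∧ l < j then D.ψ hl.1 hl.2 (x.off i l hl.1) (z.off l j hl.2) else 0) +
          (if hl : i < l ∧ l < j then D.ψ hl.1 hl.2 (y.off i l hl.1) (z.off l j hl.2) else 0) := by
        intro l
        split_ifs <;> simp
      simp only [mul_off, add_off, add_diag, smul_add, add_smul] at this ⊢
      rw [Finset.sum_congr rfl fun l _ => this l, Finset.sum_add_distrib]
      abel
  mul_assoc x y z := by
    ext i j h
    · simp [mul_assoc]
    · have h1 : ∀ l, (if hl : i < l ∧ l < j then
          D.ψ hl.1 hl.2 ((x * y).off i l hl.1) (z.off l j hl.2) else 0 : D.M i j h) =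
          x.diag i •
            (if hl : i < l ∧ l < j then D.ψ hl.1 hl.2 (y.off i l hl.1) (z.off l j hl.2) else 0) +
          (if hl : i < l ∧ l < j then
            D.ψ hl.1 hl.2 (x.off i l hl.1) (y.diag l • z.off l j hl.2) else 0) +
          (if hl : i < l ∧ l < j then D.ψ hl.1 hl.2
            (∑ k, if hk : i < k ∧ k < l then
              D.ψ hk.1 hk.2 (x.off i k hk.1) (y.off k l hk.2) else 0) (z.off l j hl.2) else 0) := by
        intro l
        split_ifs
        · simp only [mul_off, map_add, AddMonoidHom.add_apply, ψ_smul_left, ψ_balanced]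
        · simp
      have h2 : ∀ l, (if hl : i < l ∧ l < j then
          D.ψ hl.1 hl.2 (x.off i l hl.1) ((y * z).off l j hl.2) else 0 : D.M i j h) =
          (if hl : i < l ∧ l < j then
            D.ψ hl.1 hl.2 (x.off i l hl.1) (y.diag l • z.off l j hl.2) else 0) +
          op (z.diag j) •
            (if hl : i < l ∧ l < j then D.ψ hl.1 hl.2 (x.off i l hl.1) (y.off l j hl.2) else 0) +
          (if hl : i < l ∧ l < j then D.ψ hl.1 hl.2 (x.off i l hl.1)
            (∑ k, if hk : l < k ∧ k < j then
              D.ψ hk.1 hk.2 (y.off l k hk.1) (z.off k j hk.2) else 0) else 0) := by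
        intro l
        split_ifs
        · simp only [mul_off, map_add, ψ_smul_right]
        · simp
      rw [mul_off (x * y) z, mul_off x (y * z), Finset.sum_congr rfl fun l _ => h1 l,
        Finset.sum_congr rfl fun l _ => h2 l, mul_off x y, mul_off y z]
      simp only [Finset.sum_add_distrib, smul_add, mul_diag, op_mul, mul_smul, Finset.smul_sum,
        sum_assoc h x y z]
      rw [smul_comm (x.diag i) (op (z.diag j)) (y.off i j h)]
      abel
  nsmul := nsmulRec
  zsmul := zsmulRec

end MatrixRing

/-- The entry `M i t` of the column above the diagonal entry with index `t`, for `i < t`. -/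
def ColumnEntry {n : ℕ} (D : TriangularData.{u, v} n) {t : ℕ} (ht : t < n) (i : Fin t) : Type v :=
  D.M (Fin.castLE ht.le i) ⟨t, ht⟩ i.isLt

namespace ColumnEntry

variable {n : ℕ} {D : TriangularData.{u, v} n} {t : ℕ} {ht : t < n}

instance (i : Fin t) : AddCommGroup (D.ColumnEntry ht i) :=
  D.addCommGroup (Fin.castLE ht.le i) ⟨t, ht⟩ i.isLt

instance (i : Fin t) : Module ((D.leading t ht.le).R i) (D.ColumnEntry ht i) :=
  D.moduleLeft (Fin.castLE ht.le i) ⟨t, ht⟩ i.isLt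

/-- The multiplication `M i l × M l t → M i t` for `i < l < t`. -/
def mul {i l : Fin t} (h : i < l) :
    (D.leading t ht.le).M i l h →+ D.ColumnEntry ht l →+ D.ColumnEntry ht i :=
  D.ψ (i := Fin.castLE ht.le i) (l := Fin.castLE ht.le l) (j := ⟨t, ht⟩) h l.isLt

theorem mul_smul_left {i l : Fin t} (h : i < l) (r : (D.leading t ht.le).R i)
    (a : (D.leading t ht.le).M i l h) (c : D.ColumnEntry ht l) :
    mul h (r • a) c = r • mul h a c :=
  D.ψ_smul_left (i := Fin.castLE ht.le i) (l := Fin.castLE ht.le l) (j := ⟨t, ht⟩) h l.isLt r a c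

theorem mul_balanced {i l : Fin t} (h : i < l) (r : (D.leading t ht.le).R l)
    (a : (D.leading t ht.le).M i l h) (c : D.ColumnEntry ht l) :
    mul h (op r • a) c = mul h a (r • c) :=
  D.ψ_balanced (i := Fin.castLE ht.le i) (l := Fin.castLE ht.le l) (j := ⟨t, ht⟩) h l.isLt r a c

theorem mul_mul {i k l : Fin t} (h : i < k) (h' : k < l)
    (a : (D.leading t ht.le).M i k h) (b : (D.leading t ht.le).M k l h')
    (c : D.ColumnEntry ht l) :
    mul (h.trans h') ((D.leading t ht.le).ψ h h' a b) c = mul h a (mul h' b c) :=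
  D.ψ_assoc (i := Fin.castLE ht.le i) (l := Fin.castLE ht.le k) (j := Fin.castLE ht.le l)
    (t := ⟨t, ht⟩) h h' l.isLt a b c

end ColumnEntry

/-- The column above the diagonal entry with index `t`, with entries `M i t` for `i < t`. -/
@[ext]
structure Column {n : ℕ} (D : TriangularData.{u, v} n) (t : ℕ) (ht : t < n) : Type v where
  entry : ∀ i : Fin t, D.ColumnEntry ht i

namespace Column

variable {n : ℕ} {D : TriangularData.{u, v} n} {t : ℕ} {ht : t < n}

instance : Zero (D.Column t ht) := ⟨⟨fun _ => 0⟩⟩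

instance : Add (D.Column t ht) := ⟨fun c d => ⟨fun i => c.entry i + d.entry i⟩⟩

instance : Neg (D.Column t ht) := ⟨fun c => ⟨fun i => -c.entry i⟩⟩

/-- Matrix-vector multiplication: the `i`-th entry is the sum over `i ≤ l < t` of the products of
the `(i, l)`-entry and the `l`-th entry, with the term `l = i` written separately. -/
instance : SMul (D.leading t ht.le).MatrixRing (D.Column t ht) :=
  ⟨fun x c => ⟨fun i => x.diag i • c.entry i +
    ∑ l, if hl : i < l then ColumnEntry.mul hl (x.off i l hl) (c.entry l) else 0⟩⟩

@[simp] theorem zero_entry (i : Fin t) : (0 : D.Column t ht).entry i = 0 := rfl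
@[simp] theorem add_entry (c d : D.Column t ht) (i : Fin t) :
    (c + d).entry i = c.entry i + d.entry i := rfl
@[simp] theorem neg_entry (c : D.Column t ht) (i : Fin t) : (-c).entry i = -c.entry i := rfl
theorem smul_entry (x : (D.leading t ht.le).MatrixRing) (c : D.Column t ht) (i : Fin t) :
    (x • c).entry i = x.diag i • c.entry i +
      ∑ l, if hl : i < l then ColumnEntry.mul hl (x.off i l hl) (c.entry l) else 0 := rfl

instance : AddCommGroup (D.Column t ht) where
  add_assoc _ _ _ := by ext; simp [add_assoc]
  zero_add _ := by ext; simp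
  add_zero _ := by ext; simp
  add_comm _ _ := by ext; simp [add_comm]
  neg_add_cancel _ := by ext; simp
  nsmul := nsmulRec
  zsmul := zsmulRec

theorem sum_assoc (x y : (D.leading t ht.le).MatrixRing) (c : D.Column t ht) (i : Fin t) :
    (∑ l, if hl : i < l then ColumnEntry.mul hl
      (∑ k, if hk : i < k ∧ k < l then
        (D.leading t ht.le).ψ hk.1 hk.2 (x.off i k hk.1) (y.off k l hk.2) else 0)
      (c.entry l) else 0) =
    ∑ k, if hk : i < k then ColumnEntry.mul hk (x.off i k hk)
      (∑ l, if hl : k < l then ColumnEntry.mul hl (y.off k l hl) (c.entry l) else 0) else 0 := by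
  trans ∑ l, ∑ k, if hl : i < k ∧ k < l then
    ColumnEntry.mul (hl.1.trans hl.2)
      ((D.leading t ht.le).ψ hl.1 hl.2 (x.off i k hl.1) (y.off k l hl.2)) (c.entry l) else 0
  · refine Finset.sum_congr rfl fun l _ => ?_
    split_ifs with hl
    · rw [map_sum, AddMonoidHom.finsetSum_apply]
      refine Finset.sum_congr rfl fun k _ => ?_
      split_ifs <;> simp
    · exact (Finset.sum_eq_zero fun k _ => dif_neg fun hh => hl (hh.1.trans hh.2)).symm
  · rw [Finset.sum_comm]
    refine Finset.sum_congr rfl fun k _ => ?_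
    split_ifs with hk
    · rw [map_sum]
      refine Finset.sum_congr rfl fun l _ => ?_
      by_cases hl : k < l
      · rw [dif_pos hl, dif_pos ⟨hk, hl⟩, ColumnEntry.mul_mul]
      · rw [dif_neg hl, dif_neg fun hh => hl hh.2]
        simp
    · exact Finset.sum_eq_zero fun l _ => dif_neg fun hh => hk hh.1

instance : Module (D.leading t ht.le).MatrixRing (D.Column t ht) where
  one_smul c := by
    ext i
    rw [smul_entry, Finset.sum_eq_zero fun l _ => by split_ifs <;> simp]
    simp
  mul_smul x y c := by
    ext i
    have h1 : ∀ l, (if hl : i < l then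
        ColumnEntry.mul hl ((x * y).off i l hl) (c.entry l) else 0) =
        x.diag i • (if hl : i < l then ColumnEntry.mul hl (y.off i l hl) (c.entry l) else 0) +
        (if hl : i < l then
          ColumnEntry.mul hl (x.off i l hl) (y.diag l • c.entry l) else 0) +
        (if hl : i < l then ColumnEntry.mul hl
          (∑ k, if hk : i < k ∧ k < l then
            (D.leading t ht.le).ψ hk.1 hk.2 (x.off i k hk.1) (y.off k l hk.2) else 0)
          (c.entry l) else 0) := by
      intro l
      split_ifs
      · simp only [MatrixRing.mul_off, map_add, AddMonoidHom.add_apply,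
          ColumnEntry.mul_smul_left, ColumnEntry.mul_balanced]
      · simp
    have h2 : ∀ l, (if hl : i < l then
        ColumnEntry.mul hl (x.off i l hl) ((y • c).entry l) else 0) =
        (if hl : i < l then
          ColumnEntry.mul hl (x.off i l hl) (y.diag l • c.entry l) else 0) +
        (if hl : i < l then ColumnEntry.mul hl (x.off i l hl)
          (∑ k, if hk : l < k then
            ColumnEntry.mul hk (y.off l k hk) (c.entry k) else 0) else 0) := by
      intro l
      split_ifs
      · simp only [smul_entry, map_add]
      · simp
    rw [smul_entry (x * y) c, smul_entry x (y • c), Finset.sum_congr rfl fun l _ => h1 l,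
      Finset.sum_congr rfl fun l _ => h2 l, smul_entry y c]
    simp only [Finset.sum_add_distrib, smul_add, MatrixRing.mul_diag, mul_smul, Finset.smul_sum,
      sum_assoc x y c i]
    abel
  smul_zero x := by
    ext i
    rw [smul_entry, Finset.sum_eq_zero fun l _ => by split_ifs <;> simp]
    simp
  zero_smul c := by
    ext i
    rw [smul_entry, Finset.sum_eq_zero fun l _ => by split_ifs <;> simp]
    simp
  smul_add x c d := by
    ext i
    have h : ∀ l, (if hl : i < l then
        ColumnEntry.mul hl (x.off i l hl) ((c + d).entry l) else 0) =
        (if hl : i < l then ColumnEntry.mul hl (x.off i l hl) (c.entry l) else 0) +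
        (if hl : i < l then ColumnEntry.mul hl (x.off i l hl) (d.entry l) else 0) := by
      intro l
      split_ifs <;> simp
    rw [add_entry, smul_entry, smul_entry, smul_entry, Finset.sum_congr rfl fun l _ => h l,
      Finset.sum_add_distrib, add_entry, smul_add]
    abel
  add_smul x y c := by
    ext i
    have h : ∀ l, (if hl : i < l then
        ColumnEntry.mul hl ((x + y).off i l hl) (c.entry l) else 0) =
        (if hl : i < l then ColumnEntry.mul hl (x.off i l hl) (c.entry l) else 0) +
        (if hl : i < l then ColumnEntry.mul hl (y.off i l hl) (c.entry l) else 0) := by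
      intro l
      split_ifs <;> simp
    rw [add_entry, smul_entry, smul_entry, smul_entry, Finset.sum_congr rfl fun l _ => h l,
      Finset.sum_add_distrib, MatrixRing.add_diag, add_smul]
    abel

end Column

/-- All the bimodules `M i j` are finitely generated projective on both sides. -/
def BimodulesFGProjective {n : ℕ} (D : TriangularData.{u, v} n) : Prop :=
  ∀ (i j : Fin n) (h : i < j),
    (Module.Finite (D.R i) (D.M i j h) ∧ Module.Projective (D.R i) (D.M i j h)) ∧
    (Module.Finite (D.R j)ᵐᵒᵖ (D.M i j h) ∧ Module.Projective (D.R j)ᵐᵒᵖ (D.M i j h))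

end TriangularData

/-!
Write `e i` for the diagonal idempotents of the triangular ring `Γ`, so that `R i = e i Γ e i` and
`M i j = e i Γ e j`. A left `Γ`-module is an iterated extension of its components `e i X`, each
inflated along the diagonal projection `Γ → R i` (`IsExtensionClosed.of_comp`), and the inflated
module `R i` is the quotient of the projective column `Γ e i` by its part `U i` above the diagonal,
whose components lie at smaller indices. If the left modules `e i Γ` are finitely generated
projective, every module with finitely generated projective components is therefore built from
columns (`IsCoresolvingThick.of_comp_projective`).

*The bimodules are projective if `Γ` is Gorenstein*
(`TriangularPeirce.rowsFGProjective_of_injDimLT`). Proceed by induction on `i`. Dividing `Γ` by the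
rows before `i`, which have finite injective dimension by dévissage, gives a module `W` of finite
injective dimension with `e i W = e i Γ` and no components before `i`. Then `Extᵐ(U i, W) = 0` for
all `m`, so the higher extensions of inflated free `R i`-modules by `W` vanish. Finitely generated
modules over a quasi-Frobenius ring embed into finite free modules (`exists_injective_of_finite`),
and shifting dimension along such embeddings shows that `e i Γ` is injective, hence projective.

*`Γ` is Gorenstein if the bimodules are projective* (`TriangularPeirce.OpPair.exists_injDimLT`). For
an injective right `R k`-module `I` there is an exact sequence of right `Γ`-modules
`0 → I → Hom(Γ e k, I) → Hom(U k, I) → 0`. Its middle term is injective because `Γ e k` is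
projective (`Coind.baer`), and the components of its last term are injective and lie at smaller
indices, so induction applies.

*Injective dimension one.* If every `U k` is projective, the last term of the sequence is injective
as well, so the right injective dimension of `Γ` is at most one
(`TriangularPeirce.OpPair.injDimLT_two`). If the left injective dimension is at most one, then
`Extᵐ(U k, Γ) = Extᵐ⁺¹(R k, Γ) = 0` for `m ≥ 1`, and by dévissage `U k` has no extensions by modules
with finitely generated projective components, hence is projective
(`TriangularPeirce.projective_upperCol`). Applied on alternating sides, these two implications show
that projectivity of all `U k` is equivalent to injective dimension at most one on both sides.
Finally `U k` is the inflation of the column of the theorem along `Γ → Γ_t`, which preserves and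
reflects projectivity because `Γ_t` is a projective `Γ`-module.
-/

universe w

/-! ### Anti-isomorphisms -/

/-- An anti-isomorphism of rings. It lets modules over `A'` stand for right modules over `A`, so
that statements about left and right modules can be exchanged by `AntiEquiv.symm`. -/
structure AntiEquiv (A A' : Type*) [Ring A] [Ring A'] extends A ≃+ A' where
  map_mul' : ∀ x y, toFun (x * y) = toFun y * toFun x

namespace AntiEquiv

variable {A A' : Type*} [Ring A] [Ring A'] (σ : AntiEquiv A A')

theorem toAddEquiv_mul (x y : A) :
    σ.toAddEquiv (x * y) = σ.toAddEquiv y * σ.toAddEquiv x := σ.map_mul' x y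

/-- The inverse of an anti-isomorphism. -/
def symm : AntiEquiv A' A where
  toAddEquiv := σ.toAddEquiv.symm
  map_mul' x y := by
    apply σ.toAddEquiv.injective
    change σ.toAddEquiv (σ.toAddEquiv.symm _) =
      σ.toAddEquiv (σ.toAddEquiv.symm _ * σ.toAddEquiv.symm _)
    rw [toAddEquiv_mul]
    simp

theorem symm_mul (x y : A') :
    σ.toAddEquiv.symm (x * y) = σ.toAddEquiv.symm y * σ.toAddEquiv.symm x :=
  σ.symm.map_mul' x y

theorem toAddEquiv_one : σ.toAddEquiv 1 = 1 := by
  have h := σ.toAddEquiv_mul (σ.toAddEquiv.symm 1) 1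
  simpa using h.symm

theorem symm_one : σ.toAddEquiv.symm 1 = 1 := by
  rw [AddEquiv.symm_apply_eq, toAddEquiv_one]

/-- The anti-isomorphism from a ring to its opposite ring. -/
def opposite (A : Type*) [Ring A] : AntiEquiv A Aᵐᵒᵖ where
  toAddEquiv := opAddEquiv
  map_mul' _ _ := rfl

end AntiEquiv

/-! ### Baer's criterion -/

section Baer

variable {A : Type*} [Ring A] {I : Type*} [AddCommGroup I] [Module A I]

theorem Module.Baer.exists_comp_eq (h : Module.Baer A I) {X P : Type*} [AddCommGroup X]
    [Module A X] [AddCommGroup P] [Module A P] (μ : X →ₗ[A] P) (F : X →ₗ[A] I)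
    (hk : ∀ x, μ x = 0 → F x = 0) : ∃ g : P →ₗ[A] I, ∀ x, g (μ x) = F x := by
  have hinj : Function.Injective ((LinearMap.ker μ).liftQ μ le_rfl) := by
    rw [← LinearMap.ker_eq_bot, Submodule.ker_liftQ_eq_bot _ _ _ le_rfl]
  obtain ⟨g, hg⟩ := h.extension_property _ hinj ((LinearMap.ker μ).liftQ F fun x hx => hk x hx)
  refine ⟨g, fun x => ?_⟩
  exact LinearMap.congr_fun hg (Submodule.Quotient.mk x)

theorem Module.Baer.of_retract (h : Module.Baer A I) {J : Type*} [AddCommGroup J] [Module A J]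
    (i : J →ₗ[A] I) (r : I →ₗ[A] J) (hir : ∀ x, r (i x) = x) : Module.Baer A J := by
  intro a g
  obtain ⟨g', hg'⟩ := h a (i ∘ₗ g)
  exact ⟨r ∘ₗ g', fun x hx => by simp [hg' x hx, hir]⟩

theorem Module.Baer.pi {ι : Type*} {J : ι → Type*} [∀ i, AddCommGroup (J i)]
    [∀ i, Module A (J i)] (h : ∀ i, Module.Baer A (J i)) : Module.Baer A (∀ i, J i) := by
  intro a g
  choose g' hg' using fun i => h i a (LinearMap.proj i ∘ₗ g)
  exact ⟨LinearMap.pi g', fun x hx => by ext i; simp [hg' i x hx]⟩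

/-- A finitely generated projective module is a retract of a finite free one. -/
theorem Module.exists_retract_of_finite_projective (A : Type*) [Ring A] (P : Type*)
    [AddCommGroup P] [Module A P] [Module.Finite A P] [Module.Projective A P] :
    ∃ (m : ℕ) (i : P →ₗ[A] Fin m → A) (r : (Fin m → A) →ₗ[A] P), ∀ x, r (i x) = x := by
  obtain ⟨m, r, hr⟩ := Module.Finite.exists_fin' A P
  obtain ⟨i, hi⟩ := Module.projective_lifting_property r LinearMap.id hr
  exact ⟨m, i, r, fun x => LinearMap.congr_fun hi x⟩

theorem Module.Baer.of_finite_projective (h : Module.Baer A A) (P : Type*)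
    [AddCommGroup P] [Module A P] [Module.Finite A P] [Module.Projective A P] :
    Module.Baer A P := by
  obtain ⟨m, i, r, hir⟩ := Module.exists_retract_of_finite_projective A P
  exact (Module.Baer.pi fun _ => h).of_retract i r hir

end Baer

/-! ### Modules over quasi-Frobenius rings -/

section QuasiFrobenius

open AntiEquiv in
/-- Finitely generated modules over a quasi-Frobenius ring embed into finite free modules. For a
presentation `X = Aᵐ / K` the functionals on `Aᵐ` vanishing on `K` are the solutions of finitely
many equations over the opposite ring `A'`; by injectivity of `A'`, a vector killed by all
solutions is a combination of the equations, so it lies in `K`. -/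
theorem exists_injective_of_finite {A A' : Type*} [Ring A] [Ring A'] (σ : AntiEquiv A A')
    (hA : IsNoetherian A A) (hA' : IsNoetherian A' A') (hB : Module.Baer A' A')
    (X : Type*) [AddCommGroup X] [Module A X] [Module.Finite A X] :
    ∃ (q : ℕ) (f : X →ₗ[A] Fin q → A), Function.Injective f := by
  obtain ⟨m, p, hp⟩ := Module.Finite.exists_fin' A X
  have hfg : (LinearMap.ker p).FG := IsNoetherian.noetherian _
  obtain ⟨n, k, hk⟩ := Submodule.fg_iff_exists_fin_generating_family.mp hfg
  -- `θ z = 0` says that the functional `z` vanishes on the generators `k i` of the kernel, and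
  -- `η y` evaluates functionals at `y`
  let θ : (Fin m → A') →ₗ[A'] (Fin n → A') :=
    { toFun z i := ∑ l, z l * σ.toAddEquiv (k i l)
      map_add' z w := by ext i; simp [add_mul, Finset.sum_add_distrib]
      map_smul' c z := by ext i; simp [mul_assoc, Finset.mul_sum] }
  let η (y : Fin m → A) : (Fin m → A') →ₗ[A'] A' :=
    { toFun z := ∑ l, z l * σ.toAddEquiv (y l)
      map_add' z w := by simp [add_mul, Finset.sum_add_distrib]
      map_smul' c z := by simp [mul_assoc, Finset.mul_sum] }
  -- `η y` vanishes on `ker θ`, so it factors through `θ`, by injectivity of `A'`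
  have key : ∀ y, (∀ z, θ z = 0 → η y z = 0) → p y = 0 := by
    intro y hy
    obtain ⟨h, hh⟩ := hB.exists_comp_eq θ (η y) hy
    have hy' : y = ∑ i, σ.toAddEquiv.symm (h (Pi.single i 1)) • k i := by
      ext l
      apply σ.toAddEquiv.injective
      have h1 := hh (Pi.single l 1)
      have h2 : θ (Pi.single l 1) = ∑ i, σ.toAddEquiv (k i l) • Pi.single i 1 := by
        ext i
        simp [θ, Pi.single_apply]
      have h3 : η y (Pi.single l 1) = σ.toAddEquiv (y l) := by
        simp [η, Pi.single_apply]
      rw [h2, h3] at h1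
      rw [← h1]
      simp [map_sum, toAddEquiv_mul]
    have hyK : y ∈ LinearMap.ker p := by
      rw [hy', ← hk]
      exact Submodule.sum_mem _ fun i _ =>
        Submodule.smul_mem _ _ (Submodule.subset_span ⟨i, rfl⟩)
    exact hyK
  obtain ⟨q, z, hz⟩ := Submodule.fg_iff_exists_fin_generating_family.mp
    (IsNoetherian.noetherian (LinearMap.ker θ))
  let φ : (Fin m → A) →ₗ[A] (Fin q → A) :=
    { toFun y s := ∑ l, y l * σ.toAddEquiv.symm (z s l)
      map_add' z w := by ext i; simp [add_mul, Finset.sum_add_distrib]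
      map_smul' c z := by ext i; simp [mul_assoc, Finset.mul_sum] }
  have hφ : ∀ y s, σ.toAddEquiv (φ y s) = η y (z s) := by
    intro y s
    simp [φ, η, map_sum, toAddEquiv_mul]
  have hzero : ∀ y, p y = 0 → φ y = 0 := by
    intro y hy
    have hy' : y ∈ Submodule.span A (Set.range k) := by rw [hk]; exact hy
    have hle : Submodule.span A (Set.range k) ≤ LinearMap.ker φ := by
      rw [Submodule.span_le]
      rintro _ ⟨i, rfl⟩
      change φ (k i) = 0
      ext s
      apply σ.toAddEquiv.injective
      have hs : z s ∈ LinearMap.ker θ := by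
        rw [← hz]; exact Submodule.subset_span ⟨s, rfl⟩
      have h0 : η (k i) (z s) = 0 := congrFun (LinearMap.mem_ker.mp hs) i
      rw [hφ, h0]
      simp
    exact hle hy'
  obtain ⟨s, hs⟩ := hp.hasRightInverse
  have hsφ : ∀ y x, p y = x → φ (s x) = φ y := by
    intro y x hyx
    rw [← sub_eq_zero, ← map_sub]
    exact hzero _ (by rw [map_sub, hs, hyx, sub_self])
  refine ⟨q, ⟨⟨fun x => φ (s x), fun x y => ?_⟩, fun c x => ?_⟩, ?_⟩
  · rw [← map_add]
    exact hsφ _ _ (by rw [map_add, hs, hs])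
  · rw [RingHom.id_apply, ← map_smul]
    exact hsφ _ _ (by rw [map_smul, hs])
  · rw [injective_iff_map_eq_zero]
    intro x hx
    change φ (s x) = 0 at hx
    rw [← hs x]
    refine key _ fun w hw => ?_
    have hle : LinearMap.ker θ ≤ LinearMap.ker (η (s x)) := by
      rw [← hz, Submodule.span_le]
      rintro _ ⟨i, rfl⟩
      change η (s x) (z i) = 0
      rw [← hφ, hx]
      simp
    exact hle hw

end QuasiFrobenius

/-! ### Coinduced modules -/

section Coinduced

/-- The group of `Λ`-linear maps `P → I` for an `A`-`Λ`-bimodule `P` (with both actions written on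
the left), as a module over a ring `A'` anti-isomorphic to `A`. -/
def Coind {A A' : Type*} [Ring A] [Ring A'] (_ : AntiEquiv A A') (Λ P I : Type*) [Ring Λ]
    [AddCommGroup P] [Module A P] [Module Λ P] [AddCommGroup I] [Module Λ I] : Type _ :=
  P →ₗ[Λ] I

namespace Coind

variable {A A' : Type*} [Ring A] [Ring A'] {σ : AntiEquiv A A'} {Λ P I : Type*} [Ring Λ]
  [AddCommGroup P] [Module A P] [Module Λ P] [AddCommGroup I] [Module Λ I]

instance : AddCommGroup (Coind σ Λ P I) := inferInstanceAs (AddCommGroup (P →ₗ[Λ] I))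

/-- The linear map underlying an element of the coinduced module. -/
def toLin : Coind σ Λ P I ≃+ (P →ₗ[Λ] I) := AddEquiv.refl _

@[ext]
theorem ext {f g : Coind σ Λ P I} (h : ∀ p, toLin f p = toLin g p) : f = g :=
  LinearMap.ext h

variable [SMulCommClass A Λ P]

instance : Module A' (Coind σ Λ P I) where
  smul a f := toLin.symm
    { toFun p := toLin f (σ.toAddEquiv.symm a • p)
      map_add' p q := by rw [smul_add, map_add]
      map_smul' c p := by rw [smul_comm, map_smul, RingHom.id_apply] }
  one_smul f := by
    apply LinearMap.ext
    intro p
    change toLin f (σ.toAddEquiv.symm 1 • p) = toLin f p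
    rw [σ.symm_one, one_smul]
  mul_smul a b f := by
    apply LinearMap.ext
    intro p
    change toLin f (σ.toAddEquiv.symm (a * b) • p) =
      toLin f (σ.toAddEquiv.symm b • σ.toAddEquiv.symm a • p)
    rw [σ.symm_mul, mul_smul]
  smul_zero a := rfl
  smul_add a f g := rfl
  add_smul a b f := by
    apply LinearMap.ext
    intro p
    change toLin f (σ.toAddEquiv.symm (a + b) • p) =
      toLin f (σ.toAddEquiv.symm a • p) + toLin f (σ.toAddEquiv.symm b • p)
    rw [map_add, add_smul, map_add]
  zero_smul f := by
    apply LinearMap.ext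
    intro p
    change toLin f (σ.toAddEquiv.symm 0 • p) = 0
    rw [map_zero, zero_smul, map_zero]

@[simp]
theorem toLin_smul (a : A') (f : Coind σ Λ P I) (p : P) :
    toLin (a • f) p = toLin f (σ.toAddEquiv.symm a • p) := rfl

/-- If the `A`-module `P` is projective and the `Λ`-module `I` is injective, then the coinduced
module is injective. For a left ideal `J` of `A'`, a linear map from `J` to the coinduced module
is a map `J × P → I`, and by projectivity of `P` it factors through the product `J P ⊆ P`, from
where it extends to `P`. -/
theorem baer [Module.Projective A P] (hI : Module.Baer Λ I) :
    Module.Baer A' (Coind σ Λ P I) := by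
  classical
  intro J f
  -- in terms of the copower `J →₀ P`, the map `F` has to factor through the multiplication map `μ`
  let μ : (J →₀ P) →ₗ[Λ] P :=
    Finsupp.lsum ℕ fun j =>
      { toFun p := σ.toAddEquiv.symm (j : A') • p
        map_add' p q := smul_add _ p q
        map_smul' c p := smul_comm _ c p }
  let F : (J →₀ P) →ₗ[Λ] I := Finsupp.lsum ℕ fun j => toLin (f j)
  have hμ : ∀ x, μ x = x.sum fun j p => σ.toAddEquiv.symm (j : A') • p := fun x => rfl
  have hF : ∀ x, F x = x.sum fun j p => toLin (f j) p := fun x => rfl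
  obtain ⟨s, hs⟩ := Module.projective_def'.mp ‹Module.Projective A P›
  have hs' : ∀ p, (s p).sum (fun b c => c • b) = p := fun p => by
    simpa [Finsupp.linearCombination_apply] using LinearMap.congr_fun hs p
  -- in the coordinates `s` of the projective module `P`, a relation in `J P` is a family of
  -- relations in `J`, and these are respected by `f`
  have key : ∀ x, μ x = 0 → F x = 0 := by
    intro x hx
    let B : Finset P := x.support.biUnion fun j => (s (x j)).support
    have hB : ∀ j ∈ x.support, x j = ∑ b ∈ B, s (x j) b • b := by
      intro j hj
      conv_lhs => rw [← hs' (x j)]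
      exact Finsupp.sum_of_support_subset _
        (Finset.subset_biUnion_of_mem (fun j => (s (x j)).support) hj) _ (by simp)
    have h0 : ∀ b, ∑ j ∈ x.support, σ.toAddEquiv (s (x j) b) • j = 0 := by
      intro b
      have h1 : s (μ x) b = 0 := by rw [hx]; simp
      rw [hμ, Finsupp.sum, map_sum, Finsupp.finsetSum_apply] at h1
      apply Subtype.ext
      rw [AddSubmonoidClass.coe_finsetSum]
      apply σ.toAddEquiv.symm.injective
      rw [map_sum]
      simp only [map_smul, Finsupp.smul_apply, smul_eq_mul] at h1
      simp only [Submodule.coe_smul, smul_eq_mul, σ.symm_mul, AddEquiv.symm_apply_apply, h1]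
      simp
    have h2 : F x = ∑ b ∈ B, toLin (f (∑ j ∈ x.support, σ.toAddEquiv (s (x j) b) • j)) b := by
      rw [hF, Finsupp.sum]
      simp only [map_sum, map_smul, LinearMap.sum_apply, toLin_smul, AddEquiv.symm_apply_apply]
      rw [Finset.sum_comm]
      refine Finset.sum_congr rfl fun j hj => ?_
      conv_lhs => rw [hB j hj]
      rw [map_sum]
    rw [h2]
    exact Finset.sum_eq_zero fun b _ => by rw [h0]; simp
  obtain ⟨g, hg⟩ := hI.exists_comp_eq μ F key
  refine ⟨LinearMap.toSpanSingleton A' _ (toLin.symm g : Coind σ Λ P I), fun x hx => ?_⟩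
  ext p
  have := hg (Finsupp.single ⟨x, hx⟩ p)
  rw [hμ, hF, Finsupp.sum_single_index (by simp), Finsupp.sum_single_index (by simp)] at this
  simpa using this

end Coind

end Coinduced

/-! ### Short exact sequences, closure properties and Ext -/

section ShortExact

/-- The linear maps `f` and `g` form a short exact sequence `0 → X → Y → Z → 0`. -/
structure IsShortExact {A X Y Z : Type*} [Ring A] [AddCommGroup X] [Module A X] [AddCommGroup Y]
    [Module A Y] [AddCommGroup Z] [Module A Z] (f : X →ₗ[A] Y) (g : Y →ₗ[A] Z) : Prop where
  injective : Function.Injective f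
  surjective : Function.Surjective g
  exact : Function.Exact f g

variable {A : Type u} [Ring A] {X Y Z : Type w} [AddCommGroup X] [Module A X] [AddCommGroup Y]
  [Module A Y] [AddCommGroup Z] [Module A Z] {f : X →ₗ[A] Y} {g : Y →ₗ[A] Z}

theorem IsShortExact.shortExact (h : IsShortExact f g) :
    (ModuleCat.shortComplexOfCompEqZero f g h.exact.linearMap_comp_eq_zero).ShortExact :=
  ModuleCat.shortComplex_shortExact _ h.exact h.injective h.surjective

theorem isShortExact_subtype_mkQ (N : Submodule A X) : IsShortExact N.subtype N.mkQ where
  injective := N.injective_subtype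
  surjective := N.mkQ_surjective
  exact := LinearMap.exact_subtype_mkQ N

theorem isShortExact_ker_subtype (hg : Function.Surjective g) :
    IsShortExact (LinearMap.ker g).subtype g where
  injective := Submodule.injective_subtype _
  surjective := hg
  exact := LinearMap.exact_subtype_ker_map g

end ShortExact

section Closure

variable {Γ : Type w} [Ring Γ]

/-- A property of `Γ`-modules that holds for zero modules and is closed under extensions. -/
structure IsExtensionClosed (P : ∀ (X : Type w) [AddCommGroup X] [Module Γ X], Prop) : Prop where
  zero : ∀ (X : Type w) [AddCommGroup X] [Module Γ X] [Subsingleton X], P X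
  extension : ∀ {X Y Z : Type w} [AddCommGroup X] [Module Γ X] [AddCommGroup Y] [Module Γ Y]
    [AddCommGroup Z] [Module Γ Z] {f : X →ₗ[Γ] Y} {g : Y →ₗ[Γ] Z}, IsShortExact f g →
    P X → P Z → P Y

/-- A property of `Γ`-modules that holds for zero modules and is closed under extensions,
cokernels of monomorphisms and retracts. -/
structure IsCoresolvingThick (P : ∀ (X : Type w) [AddCommGroup X] [Module Γ X], Prop) : Prop
    extends IsExtensionClosed P where
  cokernel : ∀ {X Y Z : Type w} [AddCommGroup X] [Module Γ X] [AddCommGroup Y] [Module Γ Y]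
    [AddCommGroup Z] [Module Γ Z] {f : X →ₗ[Γ] Y} {g : Y →ₗ[Γ] Z}, IsShortExact f g →
    P X → P Y → P Z
  retract : ∀ {X Y : Type w} [AddCommGroup X] [Module Γ X] [AddCommGroup Y] [Module Γ Y]
    (i : X →ₗ[Γ] Y) (r : Y →ₗ[Γ] X), (∀ x, r (i x) = x) → P Y → P X

namespace IsExtensionClosed

variable {P : ∀ (X : Type w) [AddCommGroup X] [Module Γ X], Prop}
variable {X Y : Type w} [AddCommGroup X] [Module Γ X] [AddCommGroup Y] [Module Γ Y]

theorem of_equiv (hP : IsExtensionClosed P) (e : X ≃ₗ[Γ] Y) (hX : P X) : P Y :=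
  hP.extension (f := e.toLinearMap) (g := (0 : Y →ₗ[Γ] PUnit.{w + 1}))
    ⟨e.injective, fun _ => ⟨0, rfl⟩, fun y => by simp⟩ hX (hP.zero _)

theorem prod (hP : IsExtensionClosed P) (hX : P X) (hY : P Y) : P (X × Y) :=
  hP.extension (f := LinearMap.inl Γ X Y) (g := LinearMap.snd Γ X Y)
    ⟨LinearMap.inl_injective, LinearMap.snd_surjective, Function.Exact.inl_snd⟩ hX hY

theorem pi_fin (hP : IsExtensionClosed P) (hX : P X) : ∀ m : ℕ, P (Fin m → X)
  | 0 => hP.zero _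
  | m + 1 => hP.of_equiv (Fin.consLinearEquiv Γ fun _ : Fin (m + 1) => X)
      (hP.prod hX (hP.pi_fin hX m))

end IsExtensionClosed

end Closure

section Ext

variable {Γ : Type w} [Ring Γ]

/-- `Ext^m(X, Y) = 0` for all `m ≥ n`. -/
def ExtVanishes (Γ : Type w) [Ring Γ] (n : ℕ) (X Y : Type w) [AddCommGroup X] [Module Γ X]
    [AddCommGroup Y] [Module Γ Y] : Prop :=
  ∀ m, n ≤ m → ∀ e : Abelian.Ext.{w} (ModuleCat.of Γ X) (ModuleCat.of Γ Y) m, e = 0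

/-- `Y` has injective dimension less than `n`. -/
abbrev InjDimLT (Γ : Type w) [Ring Γ] (n : ℕ) (Y : Type w) [AddCommGroup Y] [Module Γ Y] : Prop :=
  HasInjectiveDimensionLT (ModuleCat.of Γ Y) n

variable {X Y Z W : Type w} [AddCommGroup X] [Module Γ X] [AddCommGroup Y] [Module Γ Y]
  [AddCommGroup Z] [Module Γ Z] [AddCommGroup W] [Module Γ W]
  {f : X →ₗ[Γ] Y} {g : Y →ₗ[Γ] Z} {n : ℕ}

open Abelian

theorem ExtVanishes.mono {n' : ℕ} (h : ExtVanishes Γ n X Y) (hn : n ≤ n') :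
    ExtVanishes Γ n' X Y :=
  fun m hm => h m (hn.trans hm)

theorem InjDimLT.extVanishes (h : InjDimLT Γ n Y) (X : Type w) [AddCommGroup X] [Module Γ X] :
    ExtVanishes Γ n X Y :=
  fun _ hm e => e.eq_zero_of_hasInjectiveDimensionLT n hm

theorem extVanishes_of_projective [Module.Projective Γ X] : ExtVanishes Γ 1 X Y := by
  have := (IsProjective.iff_projective X).mp ‹Module.Projective Γ X›
  rintro (_ | m) hm e
  · simp at hm
  · exact e.eq_zero_of_projective

theorem extVanishes_zero (h1 : ExtVanishes Γ 1 X Y) (h0 : ∀ f : X →ₗ[Γ] Y, f = 0) :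
    ExtVanishes Γ 0 X Y := by
  rintro (_ | m) _ e
  · obtain ⟨φ, rfl⟩ := Ext.homEquiv₀.symm.surjective e
    have : φ = 0 := ModuleCat.hom_ext (h0 φ.hom)
    rw [this]
    simp
  · exact h1 _ (by omega) e

theorem ExtVanishes.hom_eq_zero (h : ExtVanishes Γ 0 X Y) (f : X →ₗ[Γ] Y) : f = 0 := by
  have := h 0 le_rfl (Ext.mk₀ (ModuleCat.ofHom f))
  have h0 : ModuleCat.ofHom f = 0 := (Ext.mk₀_eq_zero_iff _).mp this
  simpa using congrArg ModuleCat.Hom.hom h0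

section Contravariant

variable (h : IsShortExact f g)
include h

theorem ExtVanishes.middle_left (hX : ExtVanishes Γ n X W) (hZ : ExtVanishes Γ n Z W) :
    ExtVanishes Γ n Y W := by
  intro m hm e
  obtain ⟨e', rfl⟩ := Ext.contravariant_sequence_exact₂ h.shortExact _ e (hX m hm _)
  rw [hZ m hm e', Ext.comp_zero]

theorem ExtVanishes.sub_left (hY : ExtVanishes Γ n Y W) (hZ : ExtVanishes Γ (n + 1) Z W) :
    ExtVanishes Γ n X W := by
  intro m hm e
  obtain ⟨e', rfl⟩ := Ext.contravariant_sequence_exact₁ h.shortExact _ e (add_comm 1 m)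
    (hZ (m + 1) (by omega) _)
  rw [hY m hm e', Ext.comp_zero]

theorem ExtVanishes.quot_left (hX : ExtVanishes Γ n X W) (hY : ExtVanishes Γ (n + 1) Y W) :
    ExtVanishes Γ (n + 1) Z W := by
  rintro (_ | m) hm e
  · simp at hm
  · obtain ⟨e', rfl⟩ := Ext.contravariant_sequence_exact₃ h.shortExact _ e
      (hY (m + 1) hm _) (add_comm 1 m)
    rw [hX m (by omega) e', Ext.comp_zero]

theorem ExtVanishes.quot_left_zero (hX : ExtVanishes Γ 0 X W) (hY : ExtVanishes Γ 0 Y W) :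
    ExtVanishes Γ 0 Z W := by
  refine extVanishes_zero (hX.quot_left h (hY.mono zero_le_one)) fun φ => ?_
  have h0 := hY.hom_eq_zero (φ ∘ₗ g)
  ext z
  obtain ⟨y, rfl⟩ := h.surjective z
  exact LinearMap.congr_fun h0 y

/-- If `Ext¹(Z, W) = 0`, then linear maps from the submodule to `W` extend. -/
theorem ExtVanishes.exists_extension (hZ : ExtVanishes Γ 1 Z W) (φ : X →ₗ[Γ] W) :
    ∃ ψ : Y →ₗ[Γ] W, ∀ x, ψ (f x) = φ x := by
  obtain ⟨e, he⟩ := Ext.contravariant_sequence_exact₁ h.shortExact _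
    (Ext.mk₀ (ModuleCat.ofHom φ)) (add_comm 1 0) (hZ 1 le_rfl _)
  obtain ⟨ψ, rfl⟩ := Ext.homEquiv₀.symm.surjective e
  simp only [Ext.homEquiv₀_symm_apply, Ext.mk₀_comp_mk₀] at he
  have := (Ext.mk₀_bijective _ _).injective he
  exact ⟨ψ.hom, fun x => LinearMap.congr_fun (congrArg ModuleCat.Hom.hom this) x⟩

end Contravariant

section Covariant

variable (h : IsShortExact f g)
include h

theorem ExtVanishes.middle_right (hX : ExtVanishes Γ n W X) (hZ : ExtVanishes Γ n W Z) :
    ExtVanishes Γ n W Y := by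
  intro m hm e
  obtain ⟨e', rfl⟩ := Ext.covariant_sequence_exact₂ _ h.shortExact e (hZ m hm _)
  rw [hX m hm e', Ext.zero_comp]

theorem ExtVanishes.quot_right (hX : ExtVanishes Γ (n + 1) W X) (hY : ExtVanishes Γ n W Y) :
    ExtVanishes Γ n W Z := by
  intro m hm e
  obtain ⟨e', rfl⟩ := Ext.covariant_sequence_exact₃ _ h.shortExact e rfl
    (hX (m + 1) (by omega) _)
  rw [hY m hm e', Ext.zero_comp]

/-- If `Ext¹(W, X) = 0`, then linear maps from `W` to the quotient lift. -/
theorem ExtVanishes.exists_lift (hX : ExtVanishes Γ 1 W X) (φ : W →ₗ[Γ] Z) :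
    ∃ ψ : W →ₗ[Γ] Y, ∀ x, g (ψ x) = φ x := by
  obtain ⟨e, he⟩ := Ext.covariant_sequence_exact₃ _ h.shortExact
    (Ext.mk₀ (ModuleCat.ofHom φ)) rfl (hX 1 le_rfl _)
  obtain ⟨ψ, rfl⟩ := Ext.homEquiv₀.symm.surjective e
  simp only [Ext.homEquiv₀_symm_apply, Ext.mk₀_comp_mk₀] at he
  have := (Ext.mk₀_bijective _ _).injective he
  exact ⟨ψ.hom, fun x => LinearMap.congr_fun (congrArg ModuleCat.Hom.hom this) x⟩

end Covariant

/-- The retract in `ModuleCat` given by two linear maps. -/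
def moduleRetract (i : X →ₗ[Γ] Y) (r : Y →ₗ[Γ] X) (hir : ∀ x, r (i x) = x) :
    Retract (ModuleCat.of Γ X) (ModuleCat.of Γ Y) where
  i := ModuleCat.ofHom i
  r := ModuleCat.ofHom r
  retract := ModuleCat.hom_ext (LinearMap.ext hir)

theorem ExtVanishes.retract_left (i : X →ₗ[Γ] Y) (r : Y →ₗ[Γ] X) (hir : ∀ x, r (i x) = x)
    (h : ExtVanishes Γ n Y W) : ExtVanishes Γ n X W := by
  intro m hm e
  let R := moduleRetract i r hir
  rw [← e.mk₀_id_comp, ← R.retract, ← Ext.mk₀_comp_mk₀, Ext.comp_assoc_of_second_deg_zero,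
    h m hm ((Ext.mk₀ R.r).comp e (zero_add m)), Ext.comp_zero]

theorem ExtVanishes.retract_right (i : X →ₗ[Γ] Y) (r : Y →ₗ[Γ] X) (hir : ∀ x, r (i x) = x)
    (h : ExtVanishes Γ n W Y) : ExtVanishes Γ n W X := by
  intro m hm e
  let R := moduleRetract i r hir
  rw [← e.comp_mk₀_id, ← R.retract, ← Ext.mk₀_comp_mk₀, ← Ext.comp_assoc_of_second_deg_zero,
    h m hm (e.comp (Ext.mk₀ R.i) (add_zero m)), Ext.zero_comp]

variable (W n) in
theorem isExtensionClosed_extVanishes_left :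
    IsExtensionClosed (fun X [AddCommGroup X] [Module Γ X] => ExtVanishes Γ n X W) where
  zero X _ _ _ m _ e := by
    have : Limits.IsZero (ModuleCat.of Γ X) := ModuleCat.isZero_of_subsingleton _
    rw [← e.mk₀_id_comp, this.eq_of_src (𝟙 _) 0, Ext.mk₀_zero, Ext.zero_comp]
  extension h hX hZ := hX.middle_left h hZ

variable (W) in
theorem isCoresolvingThick_extVanishes_left :
    IsCoresolvingThick (fun X [AddCommGroup X] [Module Γ X] => ExtVanishes Γ 0 X W) where
  toIsExtensionClosed := isExtensionClosed_extVanishes_left W 0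
  cokernel h hX hY := hX.quot_left_zero h hY
  retract i r hir h := h.retract_left i r hir

variable (W n) in
theorem isCoresolvingThick_extVanishes_right :
    IsCoresolvingThick (fun X [AddCommGroup X] [Module Γ X] => ExtVanishes Γ n W X) where
  zero X _ _ _ m _ e := by
    have : Limits.IsZero (ModuleCat.of Γ X) := ModuleCat.isZero_of_subsingleton _
    rw [← e.comp_mk₀_id, this.eq_of_src (𝟙 _) 0, Ext.mk₀_zero, Ext.comp_zero]
  extension h hX hZ := hX.middle_right h hZ
  cokernel h hX hY := (hX.mono n.le_succ).quot_right h hY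
  retract i r hir h := h.retract_right i r hir

theorem InjDimLT.mono {n' : ℕ} (h : InjDimLT Γ n Y) (hn : n ≤ n') : InjDimLT Γ n' Y :=
  hasInjectiveDimensionLT_of_ge _ n _ hn

theorem isExtensionClosed_injDimLT (Γ : Type w) [Ring Γ] (n : ℕ) :
    IsExtensionClosed (fun X [AddCommGroup X] [Module Γ X] => InjDimLT Γ n X) where
  zero X _ _ _ := by
    have := (ModuleCat.isZero_of_subsingleton (ModuleCat.of Γ X)).hasInjectiveDimensionLT_zero
    exact InjDimLT.mono this n.zero_le
  extension h hX hZ := h.shortExact.hasInjectiveDimensionLT_X₂ n hX hZ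

theorem isCoresolvingThick_injDim (Γ : Type w) [Ring Γ] :
    IsCoresolvingThick (fun X [AddCommGroup X] [Module Γ X] => ∃ n, InjDimLT Γ n X) where
  zero X _ _ _ := ⟨0, (isExtensionClosed_injDimLT Γ 0).zero X⟩
  extension h := fun ⟨n, hX⟩ ⟨m, hZ⟩ => ⟨max n m,
    h.shortExact.hasInjectiveDimensionLT_X₂ _ (InjDimLT.mono hX (le_max_left _ _))
      (InjDimLT.mono hZ (le_max_right _ _))⟩
  cokernel h := fun ⟨n, hX⟩ ⟨m, hY⟩ => ⟨max n m,
    h.shortExact.hasInjectiveDimensionLT_X₃ _ (InjDimLT.mono hY (le_max_right _ _))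
      (InjDimLT.mono hX ((le_max_left _ _).trans (Nat.le_succ _)))⟩
  retract i r hir := fun ⟨n, _⟩ =>
    ⟨n, (moduleRetract i r hir).hasInjectiveDimensionLT n⟩

theorem injDimLT_one_of_baer (h : Module.Baer Γ Y) : InjDimLT Γ 1 Y := by
  have : Module.Injective Γ Y := h.injective
  have := Module.injective_object_of_injective_module Γ Y
  infer_instance

theorem IsShortExact.injDimLT_succ (h : IsShortExact f g) (hY : Module.Baer Γ Y)
    (hZ : InjDimLT Γ n Z) : InjDimLT Γ (n + 1) X :=
  h.shortExact.hasInjectiveDimensionLT_X₁ n hZ ((injDimLT_one_of_baer hY).mono (by omega))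

end Ext

/-! ### Triangular Peirce decompositions -/

/-- A Peirce decomposition exhibiting `Γ` as an upper triangular matrix ring with diagonal rings
`R i`: complete orthogonal idempotents `e i = incl i 1` such that `e i Γ e i` is identified with
`R i` and `e i Γ e j = 0` if `j` comes before `i`. The order of the indices is given by an
injective height function, so that passing to the opposite ring does not change the index type. -/
structure TriangularPeirce (ι : Type*) [Fintype ι] (Γ : Type*) [Ring Γ] (R : ι → Type*)
    [∀ i, Ring (R i)] where
  ht : ι → ℤ
  ht_injective : Function.Injective ht
  incl : ∀ i, R i →ₙ+* Γ
  proj : ∀ i, Γ →+* R i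
  proj_incl : ∀ i r, proj i (incl i r) = r
  sum_incl_one : ∑ i, incl i 1 = 1
  orthogonal : ∀ i j, i ≠ j → incl i 1 * incl j 1 = 0
  corner : ∀ i x, incl i 1 * x * incl i 1 = incl i (proj i x)
  triangular : ∀ i j x, ht j < ht i → incl i 1 * x * incl j 1 = 0

namespace TriangularPeirce

variable {ι : Type*} [Fintype ι] {Γ : Type*} [Ring Γ] {R : ι → Type*} [∀ i, Ring (R i)]
  (T : TriangularPeirce ι Γ R)

/-- The idempotents of the Peirce decomposition. -/
def e (i : ι) : Γ := T.incl i 1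

theorem e_mul_incl (i : ι) (r : R i) : T.e i * T.incl i r = T.incl i r := by
  rw [e, ← map_mul, one_mul]

theorem incl_mul_e (i : ι) (r : R i) : T.incl i r * T.e i = T.incl i r := by
  rw [e, ← map_mul, mul_one]

theorem e_mul_e (i : ι) : T.e i * T.e i = T.e i := T.e_mul_incl i 1

theorem e_mul_e_of_ne {i j : ι} (h : i ≠ j) : T.e i * T.e j = 0 := T.orthogonal i j h

theorem sum_e : ∑ i, T.e i = 1 := T.sum_incl_one

theorem e_mul_mul_e (i : ι) (x : Γ) : T.e i * x * T.e i = T.incl i (T.proj i x) := T.corner i x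

theorem e_mul_mul_e_of_lt {i j : ι} (x : Γ) (h : T.ht j < T.ht i) : T.e i * x * T.e j = 0 :=
  T.triangular i j x h

theorem incl_injective (i : ι) : Function.Injective (T.incl i) :=
  Function.LeftInverse.injective (T.proj_incl i)

theorem proj_e (i : ι) : T.proj i (T.e i) = 1 := T.proj_incl i 1

theorem proj_e_of_ne {i j : ι} (h : i ≠ j) : T.proj i (T.e j) = 0 := by
  apply T.incl_injective
  rw [← e_mul_mul_e, T.e_mul_e_of_ne h, zero_mul, map_zero]

section Comp

variable {X Y : Type*} [AddCommGroup X] [Module Γ X] [AddCommGroup Y] [Module Γ Y]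

theorem sum_e_smul (x : X) : ∑ i, T.e i • x = x := by
  rw [← Finset.sum_smul, sum_e, one_smul]

/-- The component `e i X` of a `Γ`-module `X`. -/
def comp (i : ι) (X : Type*) [AddCommGroup X] [Module Γ X] : AddSubgroup X where
  carrier := {x | T.e i • x = x}
  zero_mem' := smul_zero _
  add_mem' {x y} hx hy := by
    change _ = _ at hx hy ⊢
    rw [smul_add, hx, hy]
  neg_mem' {x} hx := by
    change _ = _ at hx ⊢
    rw [smul_neg, hx]

theorem mem_comp {i : ι} {x : X} : x ∈ T.comp i X ↔ T.e i • x = x := Iff.rfl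

theorem e_smul_coe {i : ι} (x : T.comp i X) : T.e i • (x : X) = (x : X) := x.2

theorem e_smul_coe_of_ne {i j : ι} (h : i ≠ j) (x : T.comp j X) : T.e i • (x : X) = 0 := by
  rw [← T.e_smul_coe x, smul_smul, T.e_mul_e_of_ne h, zero_smul]

theorem e_smul_mem (i : ι) (x : X) : T.e i • x ∈ T.comp i X := by
  rw [mem_comp, smul_smul, e_mul_e]

theorem incl_smul_mem (i : ι) (r : R i) (x : X) : T.incl i r • x ∈ T.comp i X := by
  rw [mem_comp, smul_smul, e_mul_incl]

instance compModule (i : ι) : Module (R i) (T.comp i X) where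
  smul r x := ⟨T.incl i r • (x : X), T.incl_smul_mem i r (x : X)⟩
  one_smul x := Subtype.ext x.2
  mul_smul r s x := Subtype.ext (by
    change T.incl i (r * s) • (x : X) = T.incl i r • T.incl i s • (x : X)
    rw [map_mul, mul_smul])
  smul_zero r := Subtype.ext (smul_zero _)
  smul_add r x y := Subtype.ext (smul_add _ _ _)
  add_smul r s x := Subtype.ext (by
    change T.incl i (r + s) • (x : X) = T.incl i r • (x : X) + T.incl i s • (x : X)
    rw [map_add, add_smul])
  zero_smul x := Subtype.ext (by
    change T.incl i 0 • (x : X) = 0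
    rw [map_zero, zero_smul])

theorem coe_smul_comp {i : ι} (r : R i) (x : T.comp i X) :
    ((r • x : T.comp i X) : X) = T.incl i r • (x : X) := rfl

/-- The map induced by a linear map on components. -/
def compMap (i : ι) (f : X →ₗ[Γ] Y) : T.comp i X →ₗ[R i] T.comp i Y where
  toFun x := ⟨f x, by rw [mem_comp, ← map_smul, e_smul_coe]⟩
  map_add' x y := Subtype.ext (map_add f _ _)
  map_smul' r x := Subtype.ext (map_smul f _ _)

@[simp]
theorem coe_compMap {i : ι} (f : X →ₗ[Γ] Y) (x : T.comp i X) :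
    (T.compMap i f x : Y) = f x := rfl

theorem compMap_surjective {i : ι} {f : X →ₗ[Γ] Y} (hf : Function.Surjective f) :
    Function.Surjective (T.compMap i f) := by
  rintro ⟨y, hy⟩
  obtain ⟨x, rfl⟩ := hf y
  exact ⟨⟨T.e i • x, T.e_smul_mem i x⟩, Subtype.ext ((map_smul f _ _).trans hy)⟩

end Comp

section Inflation

/-- An `R i`-module, viewed as a `Γ`-module concentrated at the index `i`. -/
def Infl (_ : TriangularPeirce ι Γ R) (i : ι) (X : Type*) [AddCommGroup X] [Module (R i) X] :
    Type _ := X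

variable {i : ι} {X Y Z : Type*} [AddCommGroup X] [Module (R i) X] [AddCommGroup Y]
  [Module (R i) Y] [AddCommGroup Z] [Module (R i) Z]

instance : AddCommGroup (T.Infl i X) := inferInstanceAs (AddCommGroup X)

instance [Subsingleton X] : Subsingleton (T.Infl i X) := inferInstanceAs (Subsingleton X)

/-- The identity map from a module to its inflation. -/
def toInfl (i : ι) (X : Type*) [AddCommGroup X] [Module (R i) X] : X ≃+ T.Infl i X :=
  AddEquiv.refl X

instance : Module Γ (T.Infl i X) := Module.compHom X (T.proj i)

theorem smul_toInfl (a : Γ) (x : X) :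
    a • T.toInfl i X x = T.toInfl i X (T.proj i a • x) := rfl

/-- The map induced by a linear map on inflations. -/
def inflMap (f : X →ₗ[R i] Y) : T.Infl i X →ₗ[Γ] T.Infl i Y where
  toFun x := T.toInfl i Y (f ((T.toInfl i X).symm x))
  map_add' _ _ := map_add f _ _
  map_smul' _ _ := map_smul f _ _

theorem isShortExact_inflMap {f : X →ₗ[R i] Y} {g : Y →ₗ[R i] Z} (h : IsShortExact f g) :
    IsShortExact (T.inflMap f) (T.inflMap g) where
  injective := h.injective
  surjective := h.surjective
  exact := h.exact

/-- The equivalence induced by a linear equivalence on inflations. -/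
def inflEquiv (f : X ≃ₗ[R i] Y) : T.Infl i X ≃ₗ[Γ] T.Infl i Y where
  __ := T.inflMap f.toLinearMap
  invFun := T.inflMap f.symm.toLinearMap
  left_inv := f.symm_apply_apply
  right_inv := f.apply_symm_apply

end Inflation

section Columns

/-- The left ideal `Γ e k`. -/
def col (k : ι) : Submodule Γ Γ where
  carrier := {x | x * T.e k = x}
  zero_mem' := zero_mul _
  add_mem' {x y} hx hy := by
    change _ = _ at hx hy ⊢
    rw [add_mul, hx, hy]
  smul_mem' a x hx := by
    change _ = _ at hx ⊢
    rw [smul_eq_mul, mul_assoc, hx]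

/-- The left ideal of elements of `Γ e k` whose diagonal entry is zero. -/
def upperCol (k : ι) : Submodule Γ Γ where
  carrier := {x | x * T.e k = x ∧ T.proj k x = 0}
  zero_mem' := ⟨zero_mul _, map_zero _⟩
  add_mem' {x y} hx hy := by
    refine ⟨?_, by rw [map_add, hx.2, hy.2, add_zero]⟩
    rw [add_mul, hx.1, hy.1]
  smul_mem' a x hx := by
    refine ⟨?_, by rw [smul_eq_mul, map_mul, hx.2, mul_zero]⟩
    rw [smul_eq_mul, mul_assoc, hx.1]

theorem mem_col {k : ι} {x : Γ} : x ∈ T.col k ↔ x * T.e k = x := Iff.rfl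

theorem mem_upperCol {k : ι} {x : Γ} :
    x ∈ T.upperCol k ↔ x * T.e k = x ∧ T.proj k x = 0 := Iff.rfl

theorem upperCol_le_col (k : ι) : T.upperCol k ≤ T.col k := fun _ h => h.1

theorem e_mul_of_mem_upperCol {k : ι} {x : Γ} (h : x ∈ T.upperCol k) : T.e k * x = 0 := by
  rw [← h.1, ← mul_assoc, e_mul_mul_e, h.2, map_zero]

/-- The projection of `Γ` onto `Γ e k`. -/
def toCol (k : ι) : Γ →ₗ[Γ] T.col k where
  toFun x := ⟨x * T.e k, by rw [mem_col, mul_assoc, e_mul_e]⟩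
  map_add' x y := Subtype.ext (add_mul _ _ _)
  map_smul' a x := Subtype.ext (mul_assoc _ _ _)

theorem toCol_coe (k : ι) (x : T.col k) : T.toCol k x = x := Subtype.ext x.2

instance (k : ι) : Module.Projective Γ (T.col k) :=
  Module.Projective.of_split (T.col k).subtype (T.toCol k) (LinearMap.ext fun x => T.toCol_coe k x)

/-- The map `Γ e k → R k` taking the diagonal entry. The ring `R k` is lifted to a universe in which
it can be compared with `Γ`-modules. -/
def colDiag (k : ι) : T.col k →ₗ[Γ] T.Infl k (ULift.{v} (R k)) where
  toFun x := T.toInfl k _ (ULift.up (T.proj k x))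
  map_add' x y := by
    rw [Submodule.coe_add, map_add]
    rfl
  map_smul' a x := by
    rw [Submodule.coe_smul, smul_eq_mul, map_mul]
    rfl

theorem isShortExact_colDiag (k : ι) :
    IsShortExact (Submodule.inclusion (T.upperCol_le_col k)) (T.colDiag.{v} k) where
  injective := Submodule.inclusion_injective _
  surjective x := by
    refine ⟨⟨T.incl k ((T.toInfl k _).symm x).down, T.incl_mul_e k _⟩, ?_⟩
    change T.toInfl k _ (ULift.up (T.proj k (T.incl k _))) = x
    rw [T.proj_incl]
    rfl
  exact x := by
    constructor
    · intro h
      have h' : T.proj k x = 0 := congrArg ULift.down h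
      exact ⟨⟨x, x.2, h'⟩, rfl⟩
    · rintro ⟨y, rfl⟩
      change T.toInfl k _ (ULift.up (T.proj k y)) = 0
      rw [y.2.2]
      rfl

theorem e_smul_upperCol {k l : ι} (h : T.ht k ≤ T.ht l) (x : T.upperCol k) : T.e l • x = 0 := by
  apply Subtype.ext
  change T.e l * (x : Γ) = 0
  rcases h.lt_or_eq with h | h
  · rw [← x.2.1, ← mul_assoc, T.e_mul_mul_e_of_lt _ h]
  · rw [← T.ht_injective h]
    exact T.e_mul_of_mem_upperCol x.2

/-- Above the diagonal, right multiplication by `e k` retracts the row `e l Γ` onto its entry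
`e l Γ e k`. -/
theorem exists_retract_comp_upperCol {k l : ι} (h : k ≠ l) :
    ∃ (i : T.comp l (T.upperCol k) →ₗ[R l] T.comp l Γ)
      (r : T.comp l Γ →ₗ[R l] T.comp l (T.upperCol k)), ∀ x, r (i x) = x := by
  refine ⟨T.compMap l (T.upperCol k).subtype,
    { toFun x := ⟨⟨x * T.e k, ?_, ?_⟩, ?_⟩
      map_add' x y := Subtype.ext (Subtype.ext (add_mul _ _ _))
      map_smul' a x := Subtype.ext (Subtype.ext (mul_assoc _ _ _)) }, ?_⟩
  · rw [mul_assoc, e_mul_e]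
  · have hx : T.e l * (x : Γ) = x := x.2
    rw [← hx, map_mul, map_mul, T.proj_e_of_ne h, zero_mul, zero_mul]
  · apply Subtype.ext
    change T.e l * ((x : Γ) * T.e k) = x * T.e k
    rw [← mul_assoc]
    exact congrArg (· * T.e k) x.2
  · intro x
    apply Subtype.ext
    apply Subtype.ext
    exact x.1.2.1

end Columns

theorem comp_subsingleton {X : Type*} [AddCommGroup X] [Module Γ X] {k : ι}
    (h : ∀ x : X, T.e k • x = 0) : Subsingleton (T.comp k X) :=
  ⟨fun x y => Subtype.ext (by rw [← T.e_smul_coe x, ← T.e_smul_coe y, h, h])⟩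

section Projective

/-- Every `e k Γ` is finitely generated projective as a left `R k`-module. -/
def RowsFGProjective : Prop :=
  ∀ k, Module.Finite (R k) (T.comp k Γ) ∧ Module.Projective (R k) (T.comp k Γ)

variable {T}

theorem finite_projective_of_retract {A M N : Type*} [Ring A] [AddCommGroup M] [Module A M]
    [AddCommGroup N] [Module A N] (i : M →ₗ[A] N) (r : N →ₗ[A] M) (h : ∀ x, r (i x) = x)
    (hN : Module.Finite A N ∧ Module.Projective A N) :
    Module.Finite A M ∧ Module.Projective A M := by
  obtain ⟨_, _⟩ := hN
  exact ⟨Module.Finite.of_surjective r fun x => ⟨i x, h x⟩,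
    Module.Projective.of_split i r (LinearMap.ext h)⟩

theorem finite_projective_of_subsingleton (A M : Type*) [Ring A] [AddCommGroup M] [Module A M]
    [Subsingleton M] : Module.Finite A M ∧ Module.Projective A M :=
  ⟨inferInstance, inferInstance⟩

theorem finite_projective_comp_upperCol (k l : ι) (h : T.ht l < T.ht k →
    Module.Finite (R l) (T.comp l Γ) ∧ Module.Projective (R l) (T.comp l Γ)) :
    Module.Finite (R l) (T.comp l (T.upperCol k)) ∧
      Module.Projective (R l) (T.comp l (T.upperCol k)) := by
  by_cases hlk : T.ht l < T.ht k
  · obtain ⟨i, r, hir⟩ := T.exists_retract_comp_upperCol (k := k) (l := l)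
      (by rintro rfl; exact lt_irrefl _ hlk)
    exact finite_projective_of_retract i r hir (h hlk)
  · have := T.comp_subsingleton (T.e_smul_upperCol (not_lt.mp hlk))
    exact finite_projective_of_subsingleton _ _

end Projective

section Devissage

variable {Γ : Type w} [Ring Γ] (T : TriangularPeirce ι Γ R)
  {P : ∀ (X : Type w) [AddCommGroup X] [Module Γ X], Prop}

/-- Dévissage for modules whose components vanish outside `s`. If `k` is the last index of `s`, then
no entry of `Γ` maps another component into the one at `k`, so `x ↦ e k x` is a homomorphism onto
the inflated component, and its kernel has no component at `k`. -/
theorem extension_closed_of_comp_aux (hP : IsExtensionClosed P) (s : Finset ι) :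
    ∀ (X : Type w) [AddCommGroup X] [Module Γ X], (∀ k ∉ s, ∀ x : X, T.e k • x = 0) →
      (∀ k ∈ s, P (T.Infl k (T.comp k X))) → P X := by
  classical
  induction s using Finset.induction_on_max_value T.ht with
  | empty =>
    intro X _ _ h _
    have : Subsingleton X := ⟨fun x y => by
      rw [← T.sum_e_smul x, ← T.sum_e_smul y]
      simp [h]⟩
    exact hP.zero X
  | insert k s hk hmax ih =>
    intro X _ _ h hX
    have hlin : ∀ (a : Γ) (x : X), T.e k • a • x = T.incl k (T.proj k a) • x := by
      intro a x
      conv_lhs => rw [← T.sum_e_smul x, Finset.smul_sum, Finset.smul_sum]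
      rw [Finset.sum_eq_single k]
      · rw [smul_smul, smul_smul, e_mul_mul_e]
      · intro l _ hl
        by_cases hls : l ∈ insert k s
        · have hls' : l ∈ s := Finset.mem_of_mem_insert_of_ne hls hl
          rw [smul_smul, smul_smul, T.e_mul_mul_e_of_lt _
            ((hmax l hls').lt_of_ne fun hh => hl (T.ht_injective hh)), zero_smul]
        · rw [h l hls, smul_zero, smul_zero]
      · simp
    let g : X →ₗ[Γ] T.Infl k (T.comp k X) :=
      { toFun x := T.toInfl k _ ⟨T.e k • x, T.e_smul_mem k x⟩
        map_add' x y := congrArg (T.toInfl k _) (Subtype.ext (smul_add _ _ _))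
        map_smul' a x := congrArg (T.toInfl k _) (Subtype.ext (by
          change T.e k • a • x = T.incl k (T.proj k a) • T.e k • x
          rw [hlin, smul_smul, incl_mul_e])) }
    have hg : Function.Surjective g := fun x =>
      ⟨((T.toInfl k _).symm x : T.comp k X),
        congrArg (T.toInfl k _) (Subtype.ext (e_smul_coe _ _))⟩
    have hker : ∀ x : X, g x = 0 ↔ T.e k • x = 0 := fun x =>
      ⟨fun hx => congrArg (Subtype.val : T.comp k X → X) hx, fun hx => Subtype.ext hx⟩
    refine hP.extension (isShortExact_ker_subtype hg) (ih _ ?_ ?_)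
      (hX k (Finset.mem_insert_self k s))
    · intro l hl x
      apply Subtype.ext
      by_cases hlk : l = k
      · subst hlk
        exact (hker x).mp x.2
      · exact h l (fun hh => hl (Finset.mem_of_mem_insert_of_ne hh hlk)) x
    · intro l hl
      have hlk : k ≠ l := fun hh => hk (hh ▸ hl)
      refine hP.of_equiv (T.inflEquiv ?_) (hX l (Finset.mem_insert_of_mem hl))
      exact
        { toFun x := ⟨⟨x, (hker x).mpr (T.e_smul_coe_of_ne hlk x)⟩, Subtype.ext x.2⟩
          map_add' x y := rfl
          map_smul' r x := rfl
          invFun := T.compMap l (LinearMap.ker g).subtype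
          left_inv x := rfl
          right_inv x := rfl }

/-- A `Γ`-module is an iterated extension of its components. -/
theorem _root_.IsExtensionClosed.of_comp (hP : IsExtensionClosed P) (X : Type w) [AddCommGroup X]
    [Module Γ X] (h : ∀ k, P (T.Infl k (T.comp k X))) : P X :=
  T.extension_closed_of_comp_aux hP Finset.univ X (fun k hk => absurd (Finset.mem_univ k) hk)
    fun k _ => h k

end Devissage

section DevissageProjective

variable {ι : Type*} [Fintype ι] {Γ : Type (max u v)} [Ring Γ] {R : ι → Type u} [∀ i, Ring (R i)]
  (T : TriangularPeirce ι Γ R) {P : ∀ (X : Type (max u v)) [AddCommGroup X] [Module Γ X], Prop}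

/-- A property closed under extensions and retracts that holds for the inflated ring `R k` holds for
all inflated finitely generated projective `R k`-modules. -/
theorem of_finite_projective_infl (hP : IsExtensionClosed P)
    (hr : ∀ {X Y : Type (max u v)} [AddCommGroup X] [Module Γ X] [AddCommGroup Y] [Module Γ Y]
      (i : X →ₗ[Γ] Y) (r : Y →ₗ[Γ] X), (∀ x, r (i x) = x) → P Y → P X) {k : ι}
    (h : P (T.Infl k (ULift.{v} (R k)))) (X : Type (max u v)) [AddCommGroup X] [Module (R k) X]
    (hX : Module.Finite (R k) X ∧ Module.Projective (R k) X) : P (T.Infl k X) := by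
  obtain ⟨_, _⟩ := hX
  obtain ⟨m, i, r, hir⟩ := Module.exists_retract_of_finite_projective (R k) X
  refine hr
    (i := { toFun x a := T.toInfl k _ (ULift.up (i ((T.toInfl k X).symm x) a))
            map_add' x y := ?_
            map_smul' c x := ?_ })
    (r := { toFun y := T.toInfl k X (r fun a => ((T.toInfl k _).symm (y a)).down)
            map_add' x y := ?_
            map_smul' c x := ?_ }) ?_ (hP.pi_fin h m)
  · ext a
    rw [map_add, map_add]
    rfl
  · have : (T.toInfl k X).symm (c • x) = T.proj k c • (T.toInfl k X).symm x := rfl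
    ext a
    rw [this, map_smul]
    rfl
  · rw [← map_add, ← map_add]
    rfl
  · rw [RingHom.id_apply, smul_toInfl, ← map_smul]
    rfl
  · intro x
    exact hir _

/-- If the modules `e k Γ` with `ht k < b` are finitely generated projective over `R k`, then a
module concentrated at the index `k` with `ht k < b` and finitely generated projective over `R k`
can be built from the columns `Γ e l` with `ht l < b`. -/
theorem _root_.IsCoresolvingThick.infl (hP : IsCoresolvingThick P) (b : ℤ)
    (hrow : ∀ k, T.ht k < b →
      Module.Finite (R k) (T.comp k Γ) ∧ Module.Projective (R k) (T.comp k Γ))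
    (hcol : ∀ k, T.ht k < b → P (T.col k)) (k : ι) (hk : T.ht k < b) (X : Type (max u v))
    [AddCommGroup X] [Module (R k) X]
    (hX : Module.Finite (R k) X ∧ Module.Projective (R k) X) : P (T.Infl k X) := by
  have hwf : WellFounded fun i j => T.ht i < T.ht j :=
    Finite.wellFounded_of_trans_of_irrefl (r := fun i j => T.ht i < T.ht j)
  induction k using hwf.induction generalizing X with
  | _ k ih =>
    refine T.of_finite_projective_infl hP.toIsExtensionClosed (fun i r => hP.retract i r) ?_ X hX
    refine hP.cokernel (T.isShortExact_colDiag.{v} k) ?_ (hcol k hk)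
    refine hP.of_comp T _ fun l => ?_
    by_cases hlk : T.ht l < T.ht k
    · exact ih l hlk (hlk.trans hk) _
        (finite_projective_comp_upperCol k l fun _ => hrow l (hlk.trans hk))
    · have := T.comp_subsingleton (T.e_smul_upperCol (not_lt.mp hlk))
      exact hP.zero _

/-- If the modules `e k Γ` with `ht k < b` are finitely generated projective over `R k`, then a
module whose components are finitely generated projective, and zero at the indices of height at
least `b`, can be built from the columns `Γ e l` with `ht l < b`. -/
theorem _root_.IsCoresolvingThick.of_comp_projective (hP : IsCoresolvingThick P) (b : ℤ)
    (hrow : ∀ k, T.ht k < b →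
      Module.Finite (R k) (T.comp k Γ) ∧ Module.Projective (R k) (T.comp k Γ))
    (hcol : ∀ k, T.ht k < b → P (T.col k)) (X : Type (max u v)) [AddCommGroup X] [Module Γ X]
    (hX : ∀ k, T.ht k < b →
      Module.Finite (R k) (T.comp k X) ∧ Module.Projective (R k) (T.comp k X))
    (h0 : ∀ k, b ≤ T.ht k → ∀ x : X, T.e k • x = 0) : P X := by
  refine hP.of_comp T X fun k => ?_
  by_cases hk : T.ht k < b
  · exact hP.infl T b hrow hcol k hk _ (hX k hk)
  · have := T.comp_subsingleton (h0 k (not_lt.mp hk))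
    exact hP.zero _

end DevissageProjective

end TriangularPeirce

/-! ### Noetherian conditions -/

namespace TriangularPeirce

section Noetherian

variable {ι : Type*} [Fintype ι] {R : ι → Type*} [∀ i, Ring (R i)]

/-- A submodule `N` of the component at `k` is recovered from the `Γ`-submodule of all `y` such that
`e k a y` lies in `N` for all `a`. -/
theorem isNoetherian_comp {Γ : Type*} [Ring Γ] (T : TriangularPeirce ι Γ R) (k : ι) (X : Type*)
    [AddCommGroup X] [Module Γ X] [IsNoetherian Γ X] : IsNoetherian (R k) (T.comp k X) := by
  let g : Submodule (R k) (T.comp k X) → Submodule Γ X := fun N =>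
    { carrier := {y | ∀ a : Γ, (⟨T.e k • a • y, T.e_smul_mem k _⟩ : T.comp k X) ∈ N}
      zero_mem' a := by
        convert! N.zero_mem
        simp
      add_mem' {x y} hx hy a := by
        convert! N.add_mem (hx a) (hy a)
        simp
      smul_mem' c x hx a := by
        convert! hx (a * c) using 3
        rw [mul_smul] }
  have hg : ∀ (N : Submodule (R k) (T.comp k X)) (x : T.comp k X), (x : X) ∈ g N ↔ x ∈ N := by
    intro N x
    have h1 : ∀ a : Γ, (⟨T.e k • a • (x : X), T.e_smul_mem k _⟩ : T.comp k X) =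
        T.proj k a • x := by
      intro a
      apply Subtype.ext
      change T.e k • a • (x : X) = T.incl k (T.proj k a) • (x : X)
      rw [← e_mul_mul_e, mul_smul, mul_smul, e_smul_coe]
    refine ⟨fun h => ?_, fun h a => ?_⟩
    · have := h 1
      rwa [h1, map_one, one_smul] at this
    · rw [h1]
      exact N.smul_mem _ h
  have hmono : StrictMono g := by
    refine Monotone.strictMono_of_injective (fun N M h y hy a => h (hy a)) fun N M h => ?_
    ext x
    rw [← hg, h, hg]
  exact isNoetherian_mk hmono.wellFoundedGT

variable {Γ : Type w} [Ring Γ] (T : TriangularPeirce ι Γ R)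

theorem isNoetherian_infl (k : ι) (X : Type*) [AddCommGroup X] [Module (R k) X]
    [IsNoetherian (R k) X] : IsNoetherian Γ (T.Infl k X) := by
  let g : Submodule Γ (T.Infl k X) → Submodule (R k) X := fun N =>
    { carrier := {x | T.toInfl k X x ∈ N}
      zero_mem' := N.zero_mem
      add_mem' hx hy := N.add_mem hx hy
      smul_mem' r x hx := by
        have : T.incl k r • T.toInfl k X x ∈ N := N.smul_mem _ hx
        rwa [smul_toInfl, proj_incl] at this }
  have hmono : StrictMono g := by
    refine Monotone.strictMono_of_injective (fun N M h y hy => h hy) fun N M h => ?_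
    ext x
    exact SetLike.ext_iff.mp h ((T.toInfl k X).symm x)
  exact isNoetherian_mk hmono.wellFoundedGT

theorem isExtensionClosed_isNoetherian :
    IsExtensionClosed (fun X [AddCommGroup X] [Module Γ X] => IsNoetherian Γ X) where
  zero _ _ _ _ := inferInstance
  extension {_ _ _} _ _ _ _ _ _ f g h _ _ :=
    isNoetherian_of_range_eq_ker f g (LinearMap.exact_iff.mp h.exact).symm

theorem isNoetherian_self (hR : ∀ k, IsNoetherian (R k) (R k))
    (h : ∀ k, Module.Finite (R k) (T.comp k Γ)) : IsNoetherian Γ Γ := by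
  refine isExtensionClosed_isNoetherian.of_comp T Γ fun k => ?_
  have := h k
  have := hR k
  have : IsNoetherian (R k) (T.comp k Γ) := isNoetherian_of_isNoetherianRing_of_finite _ _
  exact T.isNoetherian_infl k _

end Noetherian

end TriangularPeirce

/-! ### Coinduced modules over triangular rings -/

namespace TriangularPeirce

/-- An anti-isomorphism between two rings with triangular Peirce decompositions, compatible with
the diagonal rings. Modules over the second ring stand for right modules over the first one. -/
structure OpPair {ι : Type*} [Fintype ι] {Γ Γ' : Type*} [Ring Γ] [Ring Γ'] {R R' : ι → Type*}
    [∀ i, Ring (R i)] [∀ i, Ring (R' i)] (T : TriangularPeirce ι Γ R)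
    (T' : TriangularPeirce ι Γ' R') where
  anti : AntiEquiv Γ Γ'
  antiDiag : ∀ i, AntiEquiv (R i) (R' i)
  anti_incl : ∀ i r, anti.toAddEquiv (T.incl i r) = T'.incl i ((antiDiag i).toAddEquiv r)

/-- A left ideal contained in `Γ e k` and stable under right multiplication by `R k`. -/
structure IsRightStable {ι : Type*} [Fintype ι] {Γ : Type*} [Ring Γ] {R : ι → Type*}
    [∀ i, Ring (R i)] (T : TriangularPeirce ι Γ R) (k : ι) (N : Submodule Γ Γ) : Prop where
  le_col : N ≤ T.col k
  mul_mem : ∀ x ∈ N, ∀ r, x * T.incl k r ∈ N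

section

variable {ι : Type*} [Fintype ι] {Γ : Type*} [Ring Γ] {R : ι → Type*} [∀ i, Ring (R i)]
  (T : TriangularPeirce ι Γ R)

theorem isRightStable_col (k : ι) : T.IsRightStable k (T.col k) where
  le_col := le_rfl
  mul_mem x _ r := by rw [mem_col, mul_assoc, incl_mul_e]

theorem isRightStable_upperCol (k : ι) : T.IsRightStable k (T.upperCol k) where
  le_col := T.upperCol_le_col k
  mul_mem x hx r := by
    rw [mem_upperCol]
    exact ⟨by rw [mul_assoc, incl_mul_e], by rw [map_mul, hx.2, zero_mul]⟩

end

namespace OpPair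

section

variable {ι : Type*} [Fintype ι] {Γ Γ' : Type*} [Ring Γ] [Ring Γ'] {R R' : ι → Type*}
  [∀ i, Ring (R i)] [∀ i, Ring (R' i)] {T : TriangularPeirce ι Γ R}
  {T' : TriangularPeirce ι Γ' R'} (S : OpPair T T')

/-- The pair with the two sides exchanged. -/
def symm : OpPair T' T where
  anti := S.anti.symm
  antiDiag i := (S.antiDiag i).symm
  anti_incl i r := by
    change S.anti.toAddEquiv.symm _ = T.incl i ((S.antiDiag i).toAddEquiv.symm r)
    rw [AddEquiv.symm_apply_eq, S.anti_incl, AddEquiv.apply_symm_apply]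

theorem anti_e (i : ι) : S.anti.toAddEquiv (T.e i) = T'.e i := by
  rw [e, S.anti_incl, (S.antiDiag i).toAddEquiv_one, e]

theorem anti_symm_e (i : ι) : S.anti.toAddEquiv.symm (T'.e i) = T.e i := by
  rw [AddEquiv.symm_apply_eq, anti_e]

theorem anti_symm_incl (i : ι) (r : R' i) :
    S.anti.toAddEquiv.symm (T'.incl i r) = T.incl i ((S.antiDiag i).toAddEquiv.symm r) :=
  S.symm.anti_incl i r

theorem proj_anti (i : ι) (x : Γ) :
    T'.proj i (S.anti.toAddEquiv x) = (S.antiDiag i).toAddEquiv (T.proj i x) := by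
  apply T'.incl_injective
  rw [← e_mul_mul_e, ← S.anti_e, ← S.anti_incl, ← e_mul_mul_e, ← AntiEquiv.toAddEquiv_mul,
    ← AntiEquiv.toAddEquiv_mul, mul_assoc]

theorem antiDiag_proj_symm (i : ι) (x : Γ') :
    (S.antiDiag i).toAddEquiv (T.proj i (S.anti.toAddEquiv.symm x)) = T'.proj i x := by
  rw [← S.proj_anti, AddEquiv.apply_symm_apply]

/-- A right stable left ideal, viewed as a bimodule over `Γ` and `R k`. The right action of `R k`
is written as an action of the ring `R' k`. -/
def Bimod (_ : OpPair T T') {k : ι} {N : Submodule Γ Γ} (_ : T.IsRightStable k N) : Type _ := N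

variable {k : ι} {N : Submodule Γ Γ} {hN : T.IsRightStable k N}

instance : AddCommGroup (S.Bimod hN) := inferInstanceAs (AddCommGroup N)

instance : Module Γ (S.Bimod hN) := inferInstanceAs (Module Γ N)

/-- The identity map from a right stable left ideal to the associated bimodule. -/
def toBimod (hN : T.IsRightStable k N) : N ≃ₗ[Γ] S.Bimod hN := LinearEquiv.refl Γ N

/-- An element of the bimodule as an element of the ring. -/
def val : S.Bimod hN →ₗ[Γ] Γ := N.subtype

theorem val_injective : Function.Injective (S.val (hN := hN)) := N.injective_subtype

theorem val_mul_e (x : S.Bimod hN) : S.val x * T.e k = S.val x := hN.le_col x.2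

instance : Module (R' k) (S.Bimod hN) where
  smul r x := S.toBimod hN
    ⟨S.val x * T.incl k ((S.antiDiag k).toAddEquiv.symm r), hN.mul_mem _ x.2 _⟩
  one_smul x := S.val_injective (by
    change S.val x * T.incl k ((S.antiDiag k).toAddEquiv.symm 1) = S.val x
    rw [AntiEquiv.symm_one]
    exact S.val_mul_e x)
  mul_smul r s x := S.val_injective (by
    change S.val x * T.incl k ((S.antiDiag k).toAddEquiv.symm (r * s)) =
      S.val x * T.incl k ((S.antiDiag k).toAddEquiv.symm s) *
        T.incl k ((S.antiDiag k).toAddEquiv.symm r)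
    rw [AntiEquiv.symm_mul, map_mul, mul_assoc])
  smul_zero r := S.val_injective (zero_mul _)
  smul_add r x y := S.val_injective (add_mul _ _ _)
  add_smul r s x := S.val_injective (by
    change S.val x * T.incl k ((S.antiDiag k).toAddEquiv.symm (r + s)) =
      S.val x * T.incl k ((S.antiDiag k).toAddEquiv.symm r) +
        S.val x * T.incl k ((S.antiDiag k).toAddEquiv.symm s)
    rw [map_add, map_add, mul_add])
  zero_smul x := S.val_injective (by
    change S.val x * T.incl k ((S.antiDiag k).toAddEquiv.symm 0) = 0
    rw [map_zero, map_zero, mul_zero])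

theorem val_smul (r : R' k) (x : S.Bimod hN) :
    S.val (r • x) = S.val x * T.incl k ((S.antiDiag k).toAddEquiv.symm r) := rfl

instance : SMulCommClass Γ (R' k) (S.Bimod hN) where
  smul_comm a r x := S.val_injective (by
    rw [map_smul, val_smul, val_smul, map_smul, smul_eq_mul, smul_eq_mul, mul_assoc])

instance [h : Module.Projective Γ N] : Module.Projective Γ (S.Bimod hN) := h

/-- The bimodule `Γ e k`. -/
abbrev Col (k : ι) : Type _ := S.Bimod (T.isRightStable_col k)

/-- The bimodule of elements of `Γ e k` with diagonal entry zero. -/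
abbrev UpperCol (k : ι) : Type _ := S.Bimod (T.isRightStable_upperCol k)

/-- The inclusion of the elements with diagonal entry zero. -/
def upperIncl (k : ι) : S.UpperCol k →ₗ[R' k] S.Col k where
  toFun x := Submodule.inclusion (T.upperCol_le_col k) x
  map_add' _ _ := rfl
  map_smul' _ _ := rfl

theorem val_upperIncl (x : S.UpperCol k) : S.val (S.upperIncl k x) = S.val x := rfl

/-- The projection of a column to its part above the diagonal. -/
def upperPart (k : ι) : S.Col k →ₗ[R' k] S.UpperCol k where
  toFun x := S.toBimod _ ⟨S.val x - T.incl k (T.proj k (S.val x)), by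
    rw [mem_upperCol, map_sub, proj_incl, sub_self, sub_mul, incl_mul_e, S.val_mul_e]
    exact ⟨rfl, rfl⟩⟩
  map_add' x y := S.val_injective (by
    change S.val (x + y) - T.incl k (T.proj k (S.val (x + y))) =
      (S.val x - T.incl k (T.proj k (S.val x))) + (S.val y - T.incl k (T.proj k (S.val y)))
    rw [map_add, map_add, map_add]
    abel)
  map_smul' r x := S.val_injective (by
    change S.val (r • x) - T.incl k (T.proj k (S.val (r • x))) =
      (S.val x - T.incl k (T.proj k (S.val x))) * T.incl k ((S.antiDiag k).toAddEquiv.symm r)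
    rw [val_smul, map_mul, map_mul, proj_incl, sub_mul])

theorem val_upperPart (x : S.Col k) :
    S.val (S.upperPart k x) = S.val x - T.incl k (T.proj k (S.val x)) := rfl

theorem upperPart_upperIncl (x : S.UpperCol k) : S.upperPart k (S.upperIncl k x) = x := by
  apply S.val_injective
  have : T.proj k (S.val x) = 0 := x.2.2
  rw [val_upperPart, val_upperIncl, this, map_zero, sub_zero]

/-- The idempotent `e k`, as an element of the column `Γ e k`. -/
def colOne (k : ι) : S.Col k := S.toBimod _ ⟨T.e k, T.e_mul_e k⟩

theorem val_colOne (k : ι) : S.val (S.colOne k) = T.e k := rfl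

theorem eq_upperIncl_add (x : S.Col k) : x = S.upperIncl k (S.upperPart k x) +
    (S.antiDiag k).toAddEquiv (T.proj k (S.val x)) • S.colOne k := by
  apply S.val_injective
  rw [map_add, val_smul, val_upperIncl, val_upperPart, val_colOne, AddEquiv.symm_apply_apply,
    e_mul_incl, sub_add_cancel]

variable {I : Type*} [AddCommGroup I] [Module (R' k) I]

/-- The embedding of an inflated module `I` into the module coinduced from the column. -/
def inflToCoind (k : ι) (I : Type*) [AddCommGroup I] [Module (R' k) I] :
    T'.Infl k I →ₗ[Γ'] Coind S.anti (R' k) (S.Col k) I where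
  toFun x := Coind.toLin.symm
    { toFun c := (S.antiDiag k).toAddEquiv (T.proj k (S.val c)) • (T'.toInfl k I).symm x
      map_add' c d := by rw [map_add, map_add, map_add, add_smul]
      map_smul' r c := by
        rw [val_smul, map_mul, proj_incl, AntiEquiv.toAddEquiv_mul, AddEquiv.apply_symm_apply,
          mul_smul, RingHom.id_apply] }
  map_add' x y := by
    ext c
    exact smul_add _ _ _
  map_smul' a x := by
    ext c
    change (S.antiDiag k).toAddEquiv (T.proj k (S.val c)) •
      T'.proj k a • (T'.toInfl k I).symm x = (S.antiDiag k).toAddEquiv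
        (T.proj k (S.val (S.anti.toAddEquiv.symm a • c))) • (T'.toInfl k I).symm x
    rw [map_smul, smul_eq_mul, map_mul, AntiEquiv.toAddEquiv_mul, antiDiag_proj_symm, mul_smul]

theorem toLin_inflToCoind (x : T'.Infl k I) (c : S.Col k) :
    Coind.toLin (S.inflToCoind k I x) c =
      (S.antiDiag k).toAddEquiv (T.proj k (S.val c)) • (T'.toInfl k I).symm x := rfl

/-- Restriction of maps from a column to its part above the diagonal. -/
def coindRestrict (k : ι) (I : Type*) [AddCommGroup I] [Module (R' k) I] :
    Coind S.anti (R' k) (S.Col k) I →ₗ[Γ'] Coind S.anti (R' k) (S.UpperCol k) I where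
  toFun f := Coind.toLin.symm (Coind.toLin f ∘ₗ S.upperIncl k)
  map_add' _ _ := rfl
  map_smul' _ _ := rfl

theorem toLin_coindRestrict (f : Coind S.anti (R' k) (S.Col k) I) (c : S.UpperCol k) :
    Coind.toLin (S.coindRestrict k I f) c = Coind.toLin f (S.upperIncl k c) := rfl

/-- The sequence `0 → I → Hom(Γ e k, I) → Hom(U, I) → 0`, where `U` is the part of `Γ e k` above
the diagonal. -/
theorem isShortExact_coindRestrict (k : ι) (I : Type*) [AddCommGroup I] [Module (R' k) I] :
    IsShortExact (S.inflToCoind k I) (S.coindRestrict k I) where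
  injective := by
    rw [injective_iff_map_eq_zero]
    intro x hx
    have h := S.toLin_inflToCoind x (S.colOne k)
    rw [hx, val_colOne, proj_e, AntiEquiv.toAddEquiv_one, one_smul] at h
    exact h.symm
  surjective f := by
    refine ⟨Coind.toLin.symm (Coind.toLin f ∘ₗ S.upperPart k), ?_⟩
    ext c
    change Coind.toLin f (S.upperPart k (S.upperIncl k c)) = Coind.toLin f c
    rw [upperPart_upperIncl]
  exact f := by
    constructor
    · intro h
      refine ⟨T'.toInfl k I (Coind.toLin f (S.colOne k)), ?_⟩
      ext c
      have h0 : Coind.toLin f (S.upperIncl k (S.upperPart k c)) = 0 := by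
        rw [← toLin_coindRestrict, h]
        rfl
      conv_rhs => rw [S.eq_upperIncl_add c]
      rw [map_add, h0, zero_add, map_smul]
      rfl
    · rintro ⟨x, rfl⟩
      ext c
      have : T.proj k (S.val c) = 0 := c.2.2
      rw [toLin_coindRestrict, toLin_inflToCoind, val_upperIncl, this, map_zero, zero_smul]
      rfl

end

section Comp

variable {ι : Type*} [Fintype ι] {Γ Γ' : Type*} [Ring Γ] [Ring Γ'] {R R' : ι → Type*}
  [∀ i, Ring (R i)] [∀ i, Ring (R' i)] {T : TriangularPeirce ι Γ R}
  {T' : TriangularPeirce ι Γ' R'} (S : OpPair T T') {Λ P I : Type*} [Ring Λ] [AddCommGroup P]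
  [Module Γ P] [Module Λ P] [SMulCommClass Γ Λ P] [AddCommGroup I] [Module Λ I]

include S in
/-- The components of a coinduced module are coinduced from the components of the bimodule. -/
theorem baer_comp_coind (l : ι) [Module.Projective (R l) (T.comp l P)] (hI : Module.Baer Λ I) :
    Module.Baer (R' l) (T'.comp l (Coind S.anti Λ P I)) := by
  let _ : Module Λ (T.comp l P) :=
    { smul r x := ⟨r • (x : P), by rw [mem_comp, smul_comm, e_smul_coe]⟩
      one_smul x := Subtype.ext (one_smul _ _)
      mul_smul r s x := Subtype.ext (mul_smul _ _ _)
      smul_zero r := Subtype.ext (smul_zero _)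
      smul_add r x y := Subtype.ext (smul_add _ _ _)
      add_smul r s x := Subtype.ext (add_smul _ _ _)
      zero_smul x := Subtype.ext (zero_smul _ _) }
  have : SMulCommClass (R l) Λ (T.comp l P) :=
    ⟨fun a r x => Subtype.ext (smul_comm (T.incl l a) r (x : P))⟩
  have hB : Module.Baer (R' l) (Coind (S.antiDiag l) Λ (T.comp l P) I) := Coind.baer hI
  refine hB.of_retract
    { toFun f := Coind.toLin.symm
        { toFun p := Coind.toLin (f : Coind S.anti Λ P I) (p : P)
          map_add' p q := map_add _ _ _
          map_smul' r p := map_smul _ _ _ }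
      map_add' f g := rfl
      map_smul' a f := ?_ }
    { toFun f := ⟨Coind.toLin.symm
        { toFun p := Coind.toLin f ⟨T.e l • p, T.e_smul_mem l p⟩
          map_add' p q := ?_
          map_smul' r p := ?_ }, ?_⟩
      map_add' f g := rfl
      map_smul' a f := ?_ } ?_
  · ext p
    change Coind.toLin (f : Coind S.anti Λ P I) (S.anti.toAddEquiv.symm (T'.incl l a) • (p : P)) =
      Coind.toLin (f : Coind S.anti Λ P I) (T.incl l ((S.antiDiag l).toAddEquiv.symm a) • (p : P))
    rw [anti_symm_incl]
  · rw [← map_add]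
    exact congrArg (Coind.toLin f) (Subtype.ext (smul_add _ _ _))
  · rw [RingHom.id_apply, ← map_smul]
    exact congrArg (Coind.toLin f) (Subtype.ext (smul_comm _ _ _))
  · rw [mem_comp]
    ext p
    change Coind.toLin f ⟨T.e l • S.anti.toAddEquiv.symm (T'.e l) • p, _⟩ =
      Coind.toLin f ⟨T.e l • p, _⟩
    refine congrArg (Coind.toLin f) (Subtype.ext ?_)
    change T.e l • S.anti.toAddEquiv.symm (T'.e l) • p = T.e l • p
    rw [anti_symm_e, smul_smul, e_mul_e]
  · apply Subtype.ext
    ext p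
    change Coind.toLin f ((S.antiDiag l).toAddEquiv.symm a • ⟨T.e l • p, _⟩) =
      Coind.toLin f ⟨T.e l • S.anti.toAddEquiv.symm (T'.incl l a) • p, _⟩
    refine congrArg (Coind.toLin f) (Subtype.ext ?_)
    change T.incl l ((S.antiDiag l).toAddEquiv.symm a) • T.e l • p =
      T.e l • S.anti.toAddEquiv.symm (T'.incl l a) • p
    rw [anti_symm_incl, smul_smul, smul_smul, incl_mul_e, e_mul_incl]
  · intro f
    apply Subtype.ext
    ext p
    change Coind.toLin (f : Coind S.anti Λ P I) (T.e l • p) = Coind.toLin (f : Coind S.anti Λ P I) p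
    conv_rhs => rw [← T'.e_smul_coe f]
    rw [Coind.toLin_smul, anti_symm_e]

end Comp

section InjectiveDimension

variable {ι : Type*} [Fintype ι] {Γ Γ' : Type w} [Ring Γ] [Ring Γ'] {R R' : ι → Type*}
  [∀ i, Ring (R i)] [∀ i, Ring (R' i)] {T : TriangularPeirce ι Γ R}
  {T' : TriangularPeirce ι Γ' R'} (S : OpPair T T')

include S in
/-- If the columns above the diagonal are projective left modules, then `Γ` has right
self-injective dimension at most one. -/
theorem injDimLT_two (hR' : ∀ k, Module.Baer (R' k) (R' k)) (hT' : T'.RowsFGProjective)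
    (hU : ∀ k, Module.Projective Γ (T.upperCol k)) : InjDimLT Γ' 2 Γ' := by
  refine (isExtensionClosed_injDimLT Γ' 2).of_comp T' Γ' fun k => ?_
  obtain ⟨_, _⟩ := hT' k
  have hI : Module.Baer (R' k) (T'.comp k Γ') := (hR' k).of_finite_projective _
  have := hU k
  exact (S.isShortExact_coindRestrict k _).injDimLT_succ (Coind.baer hI)
    (injDimLT_one_of_baer (Coind.baer hI))

include S in
/-- Inflated injective modules have finite injective dimension: the first cosyzygy in the coinduced
resolution has injective components, and they lie at smaller indices. -/
theorem exists_injDimLT_infl (hT : T.RowsFGProjective) (k : ι) :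
    ∃ n, ∀ (I : Type w) [AddCommGroup I] [Module (R' k) I], Module.Baer (R' k) I →
      InjDimLT Γ' n (T'.Infl k I) := by
  have hwf : WellFounded fun i j => T.ht i < T.ht j :=
    Finite.wellFounded_of_trans_of_irrefl (r := fun i j => T.ht i < T.ht j)
  induction k using hwf.induction with
  | _ k ih =>
    classical
    choose n hn using ih
    let N : ℕ := Finset.univ.sup fun l => if h : T.ht l < T.ht k then n l h else 0
    refine ⟨N + 1, fun I _ _ hI => ?_⟩
    refine (S.isShortExact_coindRestrict k I).injDimLT_succ (Coind.baer hI) ?_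
    refine (isExtensionClosed_injDimLT Γ' N).of_comp T' _ fun l => ?_
    by_cases hl : T.ht l < T.ht k
    · have hle : n l hl ≤ N := by
        have := Finset.le_sup (f := fun l => if h : T.ht l < T.ht k then n l h else 0)
          (Finset.mem_univ l)
        simpa only [dif_pos hl] using this
      obtain ⟨_, h⟩ := finite_projective_comp_upperCol k l fun _ => hT l
      have : Module.Projective (R l) (T.comp l (S.UpperCol k)) := h
      exact (hn l hl _ (S.baer_comp_coind l hI)).mono hle
    · have : Subsingleton (T'.comp l (Coind S.anti (R' k) (S.UpperCol k) I)) := by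
        refine T'.comp_subsingleton fun f => ?_
        ext c
        rw [Coind.toLin_smul, anti_symm_e]
        have : T.e l • c = 0 := T.e_smul_upperCol (not_lt.mp hl) c
        rw [this, map_zero, map_zero]
        rfl
      exact (isExtensionClosed_injDimLT Γ' N).zero _

include S in
/-- If all entries are projective over the diagonal rings on both sides, then `Γ` has finite right
self-injective dimension. -/
theorem exists_injDimLT (hR' : ∀ k, Module.Baer (R' k) (R' k)) (hT : T.RowsFGProjective)
    (hT' : T'.RowsFGProjective) : ∃ n, InjDimLT Γ' n Γ' := by
  refine (isCoresolvingThick_injDim Γ').of_comp T' Γ' fun k => ?_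
  obtain ⟨_, _⟩ := hT' k
  obtain ⟨n, hn⟩ := S.exists_injDimLT_infl hT k
  exact ⟨n, hn _ ((hR' k).of_finite_projective _)⟩

end InjectiveDimension

end OpPair

end TriangularPeirce

/-! ### Consequences of finite injective dimension -/

namespace TriangularPeirce

variable {ι : Type*} [Fintype ι] {Γ : Type (max u v)} [Ring Γ] {R : ι → Type u} [∀ i, Ring (R i)]
  (T : TriangularPeirce ι Γ R)

theorem exists_forall_ht_lt : ∃ b : ℤ, ∀ k, T.ht k < b := by
  obtain ⟨b, hb⟩ := (Set.finite_range T.ht).bddAbove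
  exact ⟨b + 1, fun k => Int.lt_add_one_of_le (hb ⟨k, rfl⟩)⟩

theorem finite_projective_comp_pi (h : T.RowsFGProjective) (k : ι) (m : ℕ) :
    Module.Finite (R k) (T.comp k (Fin m → Γ)) ∧
      Module.Projective (R k) (T.comp k (Fin m → Γ)) := by
  obtain ⟨_, _⟩ := h k
  have hp : Module.Projective (R k) (Fin m → T.comp k Γ) :=
    Module.Projective.of_equiv (DirectSum.linearEquivFunOnFintype (R k) (Fin m)
      fun _ => T.comp k Γ)
  refine finite_projective_of_retract (N := Fin m → T.comp k Γ)
    (LinearMap.pi fun a => T.compMap k (LinearMap.proj a))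
    { toFun y := ⟨fun a => y a, funext fun a => (y a).2⟩
      map_add' x y := rfl
      map_smul' c x := rfl } (fun x => rfl) ⟨inferInstance, hp⟩

/-- If all rows are finitely generated projective over the diagonal rings and the left
self-injective dimension of `Γ` is at most one, then the columns above the diagonal are
projective: all higher extensions of such a column `U` by `Γ` vanish, so by dévissage all
extensions by modules with finitely generated projective components vanish, and the kernel of a
finite free presentation of `U` is such a module. -/
theorem projective_upperCol (hΓ : IsNoetherian Γ Γ) (hT : T.RowsFGProjective)
    (hid : InjDimLT Γ 2 Γ) (t : ι) : Module.Projective Γ (T.upperCol t) := by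
  have hU : ExtVanishes Γ 1 (T.upperCol t) Γ :=
    extVanishes_of_projective.sub_left (T.isShortExact_colDiag.{v} t) (hid.extVanishes _)
  have hthick := isCoresolvingThick_extVanishes_right (Γ := Γ) (T.upperCol t) 1
  have hcol : ∀ k, ExtVanishes Γ 1 (T.upperCol t) (T.col k) := fun k =>
    hthick.retract (T.col k).subtype (T.toCol k) (T.toCol_coe k) hU
  obtain ⟨b, hb⟩ := T.exists_forall_ht_lt
  obtain ⟨m, p, hp⟩ := Module.Finite.exists_fin' Γ (T.upperCol t)
  have hK : ExtVanishes Γ 1 (T.upperCol t) (LinearMap.ker p) := by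
    refine hthick.of_comp_projective T b (fun k _ => hT k) (fun k _ => hcol k) _ (fun k _ => ?_)
      fun k hk => absurd (hb k) (not_lt.mpr hk)
    obtain ⟨_, _⟩ := finite_projective_comp_upperCol t k fun _ => hT k
    -- the sequence `0 → ker p → Γᵐ → U → 0` splits at each component, since the components of `U`
    -- are projective
    obtain ⟨s, hs⟩ := Module.projective_lifting_property (T.compMap k p) LinearMap.id
      (T.compMap_surjective hp)
    have hs' : ∀ x, T.compMap k p (s x) = x := fun x => LinearMap.congr_fun hs x
    refine finite_projective_of_retract (T.compMap k (LinearMap.ker p).subtype)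
      { toFun y := ⟨⟨(y - s (T.compMap k p y) : T.comp k (Fin m → Γ)), ?_⟩, ?_⟩
        map_add' x y := ?_
        map_smul' c x := ?_ } ?_ (T.finite_projective_comp_pi hT k m)
    · rw [LinearMap.mem_ker, ← coe_compMap, map_sub, hs', sub_self]
      rfl
    · apply Subtype.ext
      exact T.e_smul_coe (y - s (T.compMap k p y) : T.comp k (Fin m → Γ))
    · apply Subtype.ext
      apply Subtype.ext
      change ((x + y - s (T.compMap k p (x + y)) : T.comp k (Fin m → Γ)) : Fin m → Γ) =
        ((x - s (T.compMap k p x) + (y - s (T.compMap k p y)) : T.comp k (Fin m → Γ)) : Fin m → Γ)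
      rw [map_add, map_add, add_sub_add_comm]
    · apply Subtype.ext
      apply Subtype.ext
      change ((c • x - s (T.compMap k p (c • x)) : T.comp k (Fin m → Γ)) : Fin m → Γ) =
        ((c • (x - s (T.compMap k p x)) : T.comp k (Fin m → Γ)) : Fin m → Γ)
      rw [map_smul, map_smul, smul_sub]
    · intro x
      apply Subtype.ext
      apply Subtype.ext
      have h0 : T.compMap k p (T.compMap k (LinearMap.ker p).subtype x) = 0 :=
        Subtype.ext x.1.2
      change ((T.compMap k (LinearMap.ker p).subtype x - s (T.compMap k p
        (T.compMap k (LinearMap.ker p).subtype x)) : T.comp k (Fin m → Γ)) : Fin m → Γ) = _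
      rw [h0, map_zero, sub_zero]
      rfl
  obtain ⟨s, hs⟩ := hK.exists_lift (isShortExact_ker_subtype hp) LinearMap.id
  exact Module.Projective.of_split s p (LinearMap.ext hs)

/-- The left ideal of matrices whose rows at heights at least `b` vanish. -/
def lowRows (b : ℤ) : Submodule Γ Γ where
  carrier := {x | ∀ k, b ≤ T.ht k → T.e k * x = 0}
  zero_mem' k _ := mul_zero _
  add_mem' {x y} hx hy k hk := by rw [mul_add, hx k hk, hy k hk, add_zero]
  smul_mem' a x hx k hk := by
    rw [smul_eq_mul, ← one_mul x, ← T.sum_e, Finset.sum_mul, Finset.mul_sum, Finset.mul_sum]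
    refine Finset.sum_eq_zero fun l _ => ?_
    by_cases hl : b ≤ T.ht l
    · rw [hx l hl, mul_zero, mul_zero]
    · rw [← T.e_mul_e l, ← mul_assoc, ← mul_assoc, ← mul_assoc,
        T.e_mul_mul_e_of_lt a ((not_le.mp hl).trans_le hk), zero_mul, zero_mul]

theorem e_smul_quotient_lowRows (b : ℤ) {k : ι} (hk : T.ht k < b) (x : Γ ⧸ T.lowRows b) :
    T.e k • x = 0 := by
  obtain ⟨x, rfl⟩ := Submodule.Quotient.mk_surjective _ x
  rw [← Submodule.Quotient.mk_smul, Submodule.Quotient.mk_eq_zero]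
  intro l hl
  rw [smul_eq_mul, ← mul_assoc, T.e_mul_e_of_ne (by rintro rfl; exact not_lt.mpr hl hk), zero_mul]

theorem finite_projective_comp_lowRows (b : ℤ) {k : ι} (hk : T.ht k < b)
    (h : Module.Finite (R k) (T.comp k Γ) ∧ Module.Projective (R k) (T.comp k Γ)) :
    Module.Finite (R k) (T.comp k (T.lowRows b)) ∧
      Module.Projective (R k) (T.comp k (T.lowRows b)) := by
  refine finite_projective_of_retract (T.compMap k (T.lowRows b).subtype)
    { toFun x := ⟨⟨x, fun l hl => T.e_smul_coe_of_ne ?_ x⟩, Subtype.ext x.2⟩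
      map_add' x y := rfl
      map_smul' c x := rfl } (fun x => rfl) h
  rintro rfl
  exact not_lt.mpr hl hk

/-- The Peirce component of `Γ` at `i` does not change when the rows before `i` are divided out. -/
noncomputable def compQuotientLowRows (i : ι) :
    T.comp i Γ ≃ₗ[R i] T.comp i (Γ ⧸ T.lowRows (T.ht i)) :=
  LinearEquiv.ofBijective (T.compMap i (T.lowRows (T.ht i)).mkQ) ⟨by
    rw [injective_iff_map_eq_zero]
    intro x hx
    have h : (x : Γ) ∈ T.lowRows (T.ht i) :=
      (Submodule.Quotient.mk_eq_zero _).mp (congrArg Subtype.val hx)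
    apply Subtype.ext
    rw [← T.e_smul_coe x]
    exact h i le_rfl, T.compMap_surjective (Submodule.mkQ_surjective _)⟩

/-- If the components of `W` before `i` vanish, then linear maps over `R i` into the component at
`i` are linear maps over `Γ` from the inflated module. -/
def inflLift {W X : Type*} [AddCommGroup W] [Module Γ W] {i : ι} [AddCommGroup X] [Module (R i) X]
    (hW : ∀ k, T.ht k < T.ht i → ∀ x : W, T.e k • x = 0) (g : X →ₗ[R i] T.comp i W) :
    T.Infl i X →ₗ[Γ] W where
  toFun x := g ((T.toInfl i X).symm x)
  map_add' x y := by rw [map_add, map_add, AddSubgroup.coe_add]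
  map_smul' a x := by
    have h1 : (T.toInfl i X).symm (a • x) = T.proj i a • (T.toInfl i X).symm x := rfl
    rw [h1, map_smul, RingHom.id_apply]
    generalize g ((T.toInfl i X).symm x) = y
    rw [coe_smul_comp]
    conv_rhs => rw [← T.sum_e_smul (a • (y : W))]
    rw [Finset.sum_eq_single i]
    · conv_rhs => rw [← T.e_smul_coe y]
      rw [smul_smul, smul_smul, e_mul_mul_e]
    · intro k _ hk
      rcases lt_trichotomy (T.ht k) (T.ht i) with h | h | h
      · exact hW k h _
      · exact absurd (T.ht_injective h) hk
      · rw [← T.e_smul_coe y, smul_smul, smul_smul, T.e_mul_mul_e_of_lt _ h, zero_smul]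
    · simp

/-- Suppose that the components of `W` before `i` vanish, that `W` has finite injective dimension
and that the rows before `i` are finitely generated projective. Then the component of `W` at `i` is
injective over `R i`, provided that finitely generated modules over `R i` embed into free ones.
Indeed, the higher extensions of inflated free modules by `W` vanish, and dimension shifting along
embeddings into free modules gives `Ext¹(X, W) = 0` for all finitely generated `R i`-modules. -/
theorem baer_comp_of_injDimLT (i : ι)
    (hE : ∀ (X : Type (max u v)) [AddCommGroup X] [Module (R i) X] [Module.Finite (R i) X],
      ∃ (q : ℕ) (f : X →ₗ[R i] Fin q → R i), Function.Injective f)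
    (hrow : ∀ k, T.ht k < T.ht i →
      Module.Finite (R k) (T.comp k Γ) ∧ Module.Projective (R k) (T.comp k Γ))
    (W : Type (max u v)) [AddCommGroup W] [Module Γ W]
    (hW : ∀ k, T.ht k < T.ht i → ∀ x : W, T.e k • x = 0) (hid : ∃ n, InjDimLT Γ n W) :
    Module.Baer (R i) (T.comp i W) := by
  -- maps from `Γ e k` to `W` correspond to elements of `e k W = 0`
  have hcol : ∀ k, T.ht k < T.ht i → ExtVanishes Γ 0 (T.col k) W := by
    intro k hk
    refine extVanishes_zero extVanishes_of_projective fun f => ?_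
    ext x
    have h1 : x = (x : Γ) • (⟨T.e k, T.e_mul_e k⟩ : T.col k) := Subtype.ext x.2.symm
    have h2 : (⟨T.e k, T.e_mul_e k⟩ : T.col k) = T.e k • ⟨T.e k, T.e_mul_e k⟩ :=
      Subtype.ext (T.e_mul_e k).symm
    rw [h1, map_smul, h2, map_smul, hW k hk, smul_zero]
    rfl
  have hU : ExtVanishes Γ 0 (T.upperCol i) W :=
    (isCoresolvingThick_extVanishes_left W).of_comp_projective T (T.ht i) hrow hcol _
      (fun k _ => finite_projective_comp_upperCol i k (hrow k)) fun k hk => T.e_smul_upperCol hk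
  have hfree : ExtVanishes Γ 1 (T.Infl i (ULift.{v} (R i))) W :=
    hU.quot_left (T.isShortExact_colDiag.{v} i) extVanishes_of_projective
  have hproj : ∀ (F : Type (max u v)) [AddCommGroup F] [Module (R i) F],
      Module.Finite (R i) F ∧ Module.Projective (R i) F → ExtVanishes Γ 1 (T.Infl i F) W :=
    T.of_finite_projective_infl (isExtensionClosed_extVanishes_left W 1)
      (fun i r hir h => h.retract_left i r hir) hfree
  have hshift : ∀ m, (∀ (X : Type (max u v)) [AddCommGroup X] [Module (R i) X]
      [Module.Finite (R i) X], ExtVanishes Γ (m + 1) (T.Infl i X) W) →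
      ∀ (X : Type (max u v)) [AddCommGroup X] [Module (R i) X] [Module.Finite (R i) X],
        ExtVanishes Γ 1 (T.Infl i X) W := by
    intro m
    induction m with
    | zero => exact fun h => h
    | succ m ih =>
      intro h
      refine ih fun X _ _ _ => ?_
      obtain ⟨q, f, hf⟩ := hE X
      let f' : X →ₗ[R i] ULift.{v} (Fin q → R i) := ULift.moduleEquiv.symm.toLinearMap ∘ₗ f
      have hf' : IsShortExact f' (LinearMap.range f').mkQ :=
        ⟨ULift.moduleEquiv.symm.injective.comp hf, Submodule.mkQ_surjective _,
          LinearMap.exact_map_mkQ_range f'⟩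
      exact ((hproj _ ⟨inferInstance, inferInstance⟩).mono (by omega)).sub_left
        (T.isShortExact_inflMap hf') (h _)
  obtain ⟨n, hn⟩ := hid
  -- lifted to the universe of `Γ`-modules, a left ideal `J` of `R i` gives a short exact sequence
  -- of inflated modules, along which maps to `W` extend
  have hext := hshift n fun X _ _ _ => (InjDimLT.mono hn n.le_succ).extVanishes _
  intro J g
  let f : ULift.{v} J →ₗ[R i] ULift.{v} (R i) :=
    ULift.moduleEquiv.symm.toLinearMap ∘ₗ J.subtype ∘ₗ ULift.moduleEquiv.toLinearMap
  have hf : IsShortExact f (LinearMap.range f).mkQ :=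
    ⟨ULift.moduleEquiv.symm.injective.comp (J.injective_subtype.comp ULift.moduleEquiv.injective),
      Submodule.mkQ_surjective _, LinearMap.exact_map_mkQ_range f⟩
  obtain ⟨ψ, hψ⟩ := (hext _).exists_extension (T.isShortExact_inflMap hf)
    (T.inflLift hW (g ∘ₗ ULift.moduleEquiv.toLinearMap))
  refine ⟨{ toFun r := ⟨ψ (T.toInfl i _ (ULift.up r)), ?_⟩
            map_add' r s := ?_
            map_smul' c r := ?_ }, fun r hr => ?_⟩
  · rw [mem_comp, ← map_smul, smul_toInfl, proj_e, one_smul]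
  · apply Subtype.ext
    exact map_add ψ _ _
  · apply Subtype.ext
    change ψ (T.toInfl i _ (ULift.up (c * r))) = T.incl i c • ψ (T.toInfl i _ (ULift.up r))
    rw [← map_smul, smul_toInfl, proj_incl]
    rfl
  · exact Subtype.ext (hψ (T.toInfl i _ (ULift.up ⟨r, hr⟩)))

/-- If `Γ` is left noetherian of finite left self-injective dimension and the diagonal rings are
quasi-Frobenius, then the rows are finitely generated projective left modules. -/
theorem rowsFGProjective_of_injDimLT (hΓ : IsNoetherian Γ Γ) (hid : ∃ n, InjDimLT Γ n Γ)
    (hE : ∀ (i : ι) (X : Type (max u v)) [AddCommGroup X] [Module (R i) X]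
      [Module.Finite (R i) X], ∃ (q : ℕ) (f : X →ₗ[R i] Fin q → R i), Function.Injective f) :
    T.RowsFGProjective := by
  have hwf : WellFounded fun i j => T.ht i < T.ht j :=
    Finite.wellFounded_of_trans_of_irrefl (r := fun i j => T.ht i < T.ht j)
  intro i
  induction i using hwf.induction with
  | _ i ih =>
    have hthick := isCoresolvingThick_injDim Γ
    have hV : ∃ n, InjDimLT Γ n (T.lowRows (T.ht i)) := by
      refine hthick.of_comp_projective T (T.ht i) ih (fun k _ => ?_) _
        (fun k hk => T.finite_projective_comp_lowRows _ hk (ih k hk))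
        fun k hk x => Subtype.ext (x.2 k hk)
      exact hthick.retract (T.col k).subtype (T.toCol k) (T.toCol_coe k) hid
    have hW : ∃ n, InjDimLT Γ n (Γ ⧸ T.lowRows (T.ht i)) :=
      hthick.cokernel (isShortExact_subtype_mkQ _) hV hid
    have hB : Module.Baer (R i) (T.comp i Γ) :=
      (T.baer_comp_of_injDimLT i (hE i) ih _
        (fun k hk => T.e_smul_quotient_lowRows (T.ht i) hk) hW).of_equiv
          (T.compQuotientLowRows i).symm
    have := T.isNoetherian_comp i Γ
    have hfin : Module.Finite (R i) (T.comp i Γ) := inferInstance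
    refine ⟨hfin, ?_⟩
    obtain ⟨q, f, hf⟩ := hE i (T.comp i Γ)
    obtain ⟨g, hg⟩ := hB.exists_comp_eq f LinearMap.id
      fun x hx => hf (hx.trans (map_zero f).symm)
    exact Module.Projective.of_split f g (LinearMap.ext hg)

end TriangularPeirce

/-! ### The opposite of a triangular ring -/

section Opposite

/-- The right regular module of `A` is the left regular module of the opposite ring. -/
def opSelfEquiv (A : Type*) [Ring A] : A ≃ₗ[Aᵐᵒᵖ] Aᵐᵒᵖ where
  __ := opAddEquiv (α := A)
  map_smul' _ _ := rfl

namespace TriangularPeirce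

variable {ι : Type*} [Fintype ι] {Γ : Type*} [Ring Γ] {R : ι → Type*} [∀ i, Ring (R i)]
  (T : TriangularPeirce ι Γ R)

/-- The opposite ring of an upper triangular ring is upper triangular for the reversed order of
the indices. -/
def opposite : TriangularPeirce ι Γᵐᵒᵖ fun i => (R i)ᵐᵒᵖ where
  ht i := -T.ht i
  ht_injective i j h := T.ht_injective (neg_injective h)
  incl i :=
    { toFun r := op (T.incl i r.unop)
      map_zero' := congrArg op (map_zero (T.incl i))
      map_add' r s := congrArg op (map_add (T.incl i) _ _)
      map_mul' r s := congrArg op (map_mul (T.incl i) _ _) }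
  proj i := RingHom.op (T.proj i)
  proj_incl i r := congrArg op (T.proj_incl i r.unop)
  sum_incl_one := by
    have := congrArg op T.sum_incl_one
    rwa [Finset.op_sum] at this
  orthogonal i j h := congrArg op (T.orthogonal j i h.symm)
  corner i x := by
    have := congrArg op (T.corner i x.unop)
    rwa [mul_assoc] at this
  triangular i j x h := by
    have := congrArg op (T.triangular j i x.unop (neg_lt_neg_iff.mp h))
    rwa [mul_assoc] at this

instance (i : ι) (X : Type*) [AddCommGroup X] [Module Γᵐᵒᵖ X] :
    Module (R i)ᵐᵒᵖ (T.opposite.comp i X) :=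
  T.opposite.compModule i

/-- The pair formed by a triangular Peirce decomposition and its opposite. -/
def oppositePair : OpPair T T.opposite where
  anti := AntiEquiv.opposite Γ
  antiDiag i := AntiEquiv.opposite (R i)
  anti_incl _ _ := rfl

end TriangularPeirce

end Opposite

/-! ### Projectivity over a quotient ring -/

section ProjectiveTransfer

variable {A B N M : Type*} [Ring A] [Ring B] (ρ : A →+* B) [AddCommGroup N] [Module A N]
  [AddCommGroup M] [Module B M] (φ : N ≃+ M) (hφ : ∀ a x, φ (a • x) = ρ a • φ x)

include hφ

/-- A module over a quotient ring `B` of `A` is projective if it is projective over `A`. -/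
theorem Module.Projective.of_surjective_ringHom (hρ : Function.Surjective ρ)
    [h : Module.Projective A N] : Module.Projective B M := by
  obtain ⟨s, hs⟩ := h.out
  let s' : M →ₗ[B] (N →₀ B) :=
    { toFun m := (s (φ.symm m)).mapRange ρ (map_zero ρ)
      map_add' x y := by
        rw [map_add, map_add]
        exact Finsupp.mapRange_add (map_add ρ) _ _
      map_smul' b x := by
        obtain ⟨a, rfl⟩ := hρ b
        have : φ.symm (ρ a • x) = a • φ.symm x := by
          rw [AddEquiv.symm_apply_eq, hφ, AddEquiv.apply_symm_apply]
        rw [this, map_smul]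
        ext y
        simp }
  refine Module.Projective.of_split s' (Finsupp.linearCombination B φ) (LinearMap.ext fun m => ?_)
  have h1 := congrArg φ (hs (φ.symm m))
  rw [AddEquiv.apply_symm_apply] at h1
  conv_rhs => rw [LinearMap.id_apply, ← h1]
  rw [LinearMap.comp_apply, Finsupp.linearCombination_apply, Finsupp.linearCombination_apply]
  change ((s (φ.symm m)).mapRange ρ (map_zero ρ)).sum _ = _
  rw [Finsupp.sum_mapRange_index (by simp), Finsupp.sum, Finsupp.sum, map_sum]
  simp [hφ]

/-- If the ring `B` is projective as an `A`-module along `ρ : A → B`, with `σ` as a section of `ρ`,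
then projective modules over `B` are projective over `A`. -/
theorem Module.Projective.of_ringHom_section (σ : B →+ A) (hσ : ∀ b, ρ (σ b) = b)
    (hσ' : ∀ a b, σ (ρ a * b) = a * σ b) [h : Module.Projective B M] :
    Module.Projective A N := by
  obtain ⟨s, hs⟩ := h.out
  let s' : N →ₗ[A] (M →₀ A) :=
    { toFun x := (s (φ x)).mapRange σ (map_zero σ)
      map_add' x y := by
        rw [map_add, map_add]
        exact Finsupp.mapRange_add (map_add σ) _ _
      map_smul' a x := by
        rw [hφ, map_smul]
        ext y
        simp [hσ'] }
  refine Module.Projective.of_split s' (Finsupp.linearCombination A φ.symm)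
    (LinearMap.ext fun x => φ.injective ?_)
  conv_rhs => rw [LinearMap.id_apply, ← hs (φ x)]
  rw [LinearMap.comp_apply, Finsupp.linearCombination_apply, Finsupp.linearCombination_apply]
  change φ (((s (φ x)).mapRange σ (map_zero σ)).sum _) = _
  rw [Finsupp.sum_mapRange_index (by simp), Finsupp.sum, Finsupp.sum, map_sum]
  simp [hφ, hσ]

end ProjectiveTransfer

section Retracts

theorem finite_projective_pi_iff {A : Type*} [Ring A] {κ : Type*} [Finite κ] {M : κ → Type*}
    [∀ k, AddCommGroup (M k)] [∀ k, Module A (M k)] :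
    (Module.Finite A (A × ∀ k, M k) ∧ Module.Projective A (A × ∀ k, M k)) ↔
      ∀ k, Module.Finite A (M k) ∧ Module.Projective A (M k) := by
  classical
  have := Fintype.ofFinite κ
  constructor
  · intro h k
    exact TriangularPeirce.finite_projective_of_retract
      (LinearMap.inr A A (∀ k, M k) ∘ₗ LinearMap.single A M k)
      (LinearMap.proj k ∘ₗ LinearMap.snd A A (∀ k, M k)) (fun x => by simp) h
  · intro h
    have := fun k => (h k).1
    have := fun k => (h k).2
    have hp : Module.Projective A (∀ k, M k) :=
      Module.Projective.of_equiv (DirectSum.linearEquivFunOnFintype A κ M)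
    exact ⟨inferInstance, inferInstance⟩

theorem finite_projective_congr {A M N : Type*} [Ring A] [AddCommGroup M] [Module A M]
    [AddCommGroup N] [Module A N] (e : M ≃ₗ[A] N) :
    (Module.Finite A M ∧ Module.Projective A M) ↔
      (Module.Finite A N ∧ Module.Projective A N) :=
  ⟨TriangularPeirce.finite_projective_of_retract e.symm.toLinearMap e.toLinearMap
      e.apply_symm_apply,
    TriangularPeirce.finite_projective_of_retract e.toLinearMap e.symm.toLinearMap
      e.symm_apply_apply⟩

end Retracts

/-! ### The upper triangular matrix ring -/

namespace TriangularData

variable {n : ℕ} (D : TriangularData.{u, v} n)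

namespace MatrixRing

variable {D}

/-- The diagonal matrix with the single entry `r` at the index `i`. -/
def single (i : Fin n) (r : D.R i) : D.MatrixRing := ⟨Pi.single i r, fun _ _ _ => 0⟩

theorem single_mul_diag (i : Fin n) (r : D.R i) (x : D.MatrixRing) (k : Fin n) :
    (single i r * x).diag k = (Pi.single i r : ∀ i, D.R i) k * x.diag k := rfl

theorem single_mul_off (i : Fin n) (r : D.R i) (x : D.MatrixRing) {k j : Fin n} (h : k < j) :
    (single i r * x).off k j h = (Pi.single i r : ∀ i, D.R i) k • x.off k j h := by
  rw [mul_off, Finset.sum_eq_zero fun l _ => by split_ifs <;> simp [single]]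
  simp [single]

theorem mul_single_diag (i : Fin n) (r : D.R i) (x : D.MatrixRing) (k : Fin n) :
    (x * single i r).diag k = x.diag k * (Pi.single i r : ∀ i, D.R i) k := rfl

theorem mul_single_off (i : Fin n) (r : D.R i) (x : D.MatrixRing) {k j : Fin n} (h : k < j) :
    (x * single i r).off k j h = op ((Pi.single i r : ∀ i, D.R i) j) • x.off k j h := by
  rw [mul_off, Finset.sum_eq_zero fun l _ => by split_ifs <;> simp [single]]
  simp [single]

/-- The additive map taking the diagonal entries of a matrix. -/
def diagHom (D : TriangularData.{u, v} n) : D.MatrixRing →+ ∀ i, D.R i where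
  toFun := diag
  map_zero' := rfl
  map_add' _ _ := rfl

end MatrixRing

open MatrixRing

/-- The Peirce decomposition of an upper triangular matrix ring. -/
def peirce : TriangularPeirce (Fin n) D.MatrixRing D.R where
  ht i := (i : ℤ)
  ht_injective i j h := Fin.ext (Int.ofNat_inj.mp h)
  incl i :=
    { toFun := single i
      map_zero' := by
        ext k
        · simp [single]
        · rfl
      map_add' r s := by
        ext k
        · simp [single, Pi.single_add]
        · simp [single]
      map_mul' r s := by
        ext k j h
        · simp [single, Pi.single_mul]
        · rw [single_mul_off]
          simp [single] }
  proj i :=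
    { toFun x := x.diag i
      map_zero' := rfl
      map_one' := rfl
      map_add' _ _ := rfl
      map_mul' _ _ := rfl }
  proj_incl i r := Pi.single_eq_same i r
  sum_incl_one := by
    ext k j h
    · have := congrFun (map_sum (diagHom D) (fun i => single i (1 : D.R i)) Finset.univ) k
      refine this.trans ?_
      rw [Finset.sum_apply]
      simp only [diagHom, single, AddMonoidHom.coe_mk, ZeroHom.coe_mk]
      rw [Finset.sum_pi_single]
      simp
    · let f : D.MatrixRing →+ D.M k j h :=
        { toFun x := x.off k j h, map_zero' := rfl, map_add' _ _ := rfl }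
      exact (map_sum f _ _).trans (Finset.sum_eq_zero fun _ _ => rfl)
  orthogonal i j h := by
    change single i 1 * single j 1 = 0
    ext k l hkl
    · rw [single_mul_diag]
      by_cases hk : k = i
      · subst hk
        simp [single, h]
      · simp [hk]
    · rw [single_mul_off]
      simp [single]
  corner i x := by
    change single i 1 * x * single i 1 = single i (x.diag i)
    ext k l hkl
    · rw [mul_single_diag, single_mul_diag]
      by_cases hk : k = i
      · subst hk
        simp [single]
      · simp [single, hk]
    · rw [mul_single_off, single_mul_off]
      by_cases hk : k = i
      · subst hk
        simp [single, hkl.ne']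
      · simp [single, hk]
  triangular i j x h := by
    change single i 1 * x * single j 1 = 0
    have h' : j < i := by simpa using h
    ext k l hkl
    · rw [mul_single_diag, single_mul_diag]
      by_cases hk : k = i
      · subst hk
        simp [h'.ne']
      · simp [hk]
    · rw [mul_single_off, single_mul_off]
      by_cases hk : k = i
      · subst hk
        simp [(h'.trans hkl).ne']
      · simp [hk]

variable {D}

/-- The matrix with a given row and zeros elsewhere. -/
def rowMatrix (i : Fin n) (a : D.R i) (m : ∀ j : {j // i < j}, D.M i j j.2) : D.MatrixRing where
  diag := Pi.single i a
  off k j h := if hk : i = k then by subst hk; exact m ⟨j, h⟩ else 0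

theorem rowMatrix_off_self (i : Fin n) (a : D.R i) (m : ∀ j : {j // i < j}, D.M i j j.2)
    {j : Fin n} (h : i < j) : (rowMatrix i a m).off i j h = m ⟨j, h⟩ := dif_pos rfl

theorem rowMatrix_off_of_ne {i : Fin n} (a : D.R i) (m : ∀ j : {j // i < j}, D.M i j j.2)
    {k j : Fin n} (h : k < j) (hk : i ≠ k) : (rowMatrix i a m).off k j h = 0 := dif_neg hk

/-- The matrix with a given column and zeros elsewhere. -/
def colMatrix (j : Fin n) (a : D.R j) (m : ∀ i : {i // i < j}, D.M i j i.2) : D.MatrixRing where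
  diag := Pi.single j a
  off i k h := if hk : j = k then by subst hk; exact m ⟨i, h⟩ else 0

theorem colMatrix_off_self (j : Fin n) (a : D.R j) (m : ∀ i : {i // i < j}, D.M i j i.2)
    {i : Fin n} (h : i < j) : (colMatrix j a m).off i j h = m ⟨i, h⟩ := dif_pos rfl

theorem colMatrix_off_of_ne {j : Fin n} (a : D.R j) (m : ∀ i : {i // i < j}, D.M i j i.2)
    {i k : Fin n} (h : i < k) (hk : j ≠ k) : (colMatrix j a m).off i k h = 0 := dif_neg hk

theorem single_one_mul_eq_iff (i : Fin n) (x : D.MatrixRing) :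
    single i 1 * x = x ↔ x = rowMatrix i (x.diag i) fun j => x.off i j j.2 := by
  have : single i 1 * x = rowMatrix i (x.diag i) fun j => x.off i j j.2 := by
    ext k j h
    · rw [single_mul_diag]
      by_cases hk : k = i
      · subst hk
        simp [rowMatrix]
      · simp [rowMatrix, hk]
    · rw [single_mul_off]
      by_cases hk : i = k
      · subst hk
        rw [rowMatrix_off_self, Pi.single_eq_same, one_smul]
      · rw [rowMatrix_off_of_ne _ _ h hk, Pi.single_eq_of_ne' hk, zero_smul]
  rw [this]
  exact eq_comm

theorem mul_single_one_eq_iff (j : Fin n) (x : D.MatrixRing) :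
    x * single j 1 = x ↔ x = colMatrix j (x.diag j) fun i => x.off i j i.2 := by
  have : x * single j 1 = colMatrix j (x.diag j) fun i => x.off i j i.2 := by
    ext i k h
    · rw [mul_single_diag]
      by_cases hk : i = j
      · subst hk
        simp [colMatrix]
      · simp [colMatrix, hk]
    · rw [mul_single_off]
      by_cases hk : j = k
      · subst hk
        rw [colMatrix_off_self, Pi.single_eq_same, op_one, one_smul]
      · rw [colMatrix_off_of_ne _ _ h hk, Pi.single_eq_of_ne' hk, op_zero, zero_smul]
  rw [this]
  exact eq_comm

theorem rowMatrix_mem (i : Fin n) (a : D.R i) (m : ∀ j : {j // i < j}, D.M i j j.2) :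
    single i 1 * rowMatrix i a m = rowMatrix i a m := by
  rw [single_one_mul_eq_iff]
  congr 1
  · exact (Pi.single_eq_same i a).symm
  · funext j
    exact (rowMatrix_off_self i a m j.2).symm

theorem colMatrix_mem (j : Fin n) (a : D.R j) (m : ∀ i : {i // i < j}, D.M i j i.2) :
    colMatrix j a m * single j 1 = colMatrix j a m := by
  rw [mul_single_one_eq_iff]
  congr 1
  · exact (Pi.single_eq_same j a).symm
  · funext i
    exact (colMatrix_off_self j a m i.2).symm

/-- The `i`-th row of the matrix ring as a left `R i`-module. -/
def rowEquiv (D : TriangularData.{u, v} n) (i : Fin n) :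
    D.peirce.comp i D.MatrixRing ≃ₗ[D.R i] D.R i × ∀ j : {j // i < j}, D.M i j j.2 where
  toFun x := ((x : D.MatrixRing).diag i, fun j => (x : D.MatrixRing).off i j j.2)
  map_add' x y := rfl
  map_smul' r x := by
    refine Prod.ext ?_ (funext fun j => ?_)
    · change (single i r * (x : D.MatrixRing)).diag i = r * (x : D.MatrixRing).diag i
      rw [single_mul_diag, Pi.single_eq_same]
    · change (single i r * (x : D.MatrixRing)).off i j j.2 = r • (x : D.MatrixRing).off i j j.2
      rw [single_mul_off, Pi.single_eq_same]
  invFun y := ⟨rowMatrix i y.1 y.2, rowMatrix_mem i y.1 y.2⟩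
  left_inv x := Subtype.ext ((single_one_mul_eq_iff i _).mp x.2).symm
  right_inv y := Prod.ext (Pi.single_eq_same i y.1)
    (funext fun j => rowMatrix_off_self i y.1 y.2 j.2)

/-- The `j`-th column of the matrix ring as a right `R j`-module. -/
def colEquiv (D : TriangularData.{u, v} n) (j : Fin n) :
    D.peirce.opposite.comp j D.MatrixRingᵐᵒᵖ ≃ₗ[(D.R j)ᵐᵒᵖ]
      (D.R j)ᵐᵒᵖ × ∀ i : {i // i < j}, D.M i j i.2 where
  toFun x := (op ((x : D.MatrixRingᵐᵒᵖ).unop.diag j),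
    fun i => (x : D.MatrixRingᵐᵒᵖ).unop.off i j i.2)
  map_add' x y := rfl
  map_smul' r x := by
    refine Prod.ext (congrArg op ?_) (funext fun i => ?_)
    · change ((x : D.MatrixRingᵐᵒᵖ).unop * single j r.unop).diag j =
        (x : D.MatrixRingᵐᵒᵖ).unop.diag j * r.unop
      rw [mul_single_diag, Pi.single_eq_same]
    · change ((x : D.MatrixRingᵐᵒᵖ).unop * single j r.unop).off i j i.2 =
        r • (x : D.MatrixRingᵐᵒᵖ).unop.off i j i.2
      rw [mul_single_off, Pi.single_eq_same, op_unop]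
  invFun y := ⟨op (colMatrix j y.1.unop y.2), congrArg op (colMatrix_mem j y.1.unop y.2)⟩
  left_inv x := Subtype.ext
    (congrArg op ((mul_single_one_eq_iff j _).mp (congrArg unop x.2)).symm)
  right_inv y := Prod.ext (congrArg op (Pi.single_eq_same j y.1.unop))
    (funext fun i => colMatrix_off_self j y.1.unop y.2 i.2)

theorem bimodulesFGProjective_iff (D : TriangularData.{u, v} n) : D.BimodulesFGProjective ↔
    D.peirce.RowsFGProjective ∧ D.peirce.opposite.RowsFGProjective := by
  have h1 : D.peirce.RowsFGProjective ↔ ∀ (i j : Fin n) (h : i < j),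
      Module.Finite (D.R i) (D.M i j h) ∧ Module.Projective (D.R i) (D.M i j h) := by
    refine forall_congr' fun i => ?_
    rw [finite_projective_congr (D.rowEquiv i), finite_projective_pi_iff, Subtype.forall]
  have h2 : D.peirce.opposite.RowsFGProjective ↔ ∀ (j i : Fin n) (h : i < j),
      Module.Finite (D.R j)ᵐᵒᵖ (D.M i j h) ∧ Module.Projective (D.R j)ᵐᵒᵖ (D.M i j h) := by
    refine forall_congr' fun j => ?_
    exact (finite_projective_congr (D.colEquiv j)).trans
      (finite_projective_pi_iff.trans Subtype.forall)
  rw [h1, h2]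
  exact ⟨fun h => ⟨fun i j hij => (h i j hij).1, fun j i hij => (h i j hij).2⟩,
    fun h i j hij => ⟨h.1 i j hij, h.2 j i hij⟩⟩

/-! ### Leading principal submatrices -/

section Leading

theorem sum_castLE {t : ℕ} (ht : t ≤ n) {M : Type*} [AddCommMonoid M] (f : Fin n → M)
    (hf : ∀ l : Fin n, t ≤ l → f l = 0) : ∑ l, f l = ∑ l : Fin t, f (Fin.castLE ht l) := by
  refine (Fintype.sum_of_injective (Fin.castLE ht) (Fin.castLE_injective ht) _ _ ?_
    fun _ => rfl).symm
  intro l hl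
  refine hf l (not_lt.mp fun h => hl ⟨⟨l, h⟩, rfl⟩)

/-- The ring homomorphism to the ring of leading principal submatrices. -/
def toLeading (D : TriangularData.{u, v} n) (t : ℕ) (ht : t ≤ n) :
    D.MatrixRing →+* (D.leading t ht).MatrixRing where
  toFun x := ⟨fun i => x.diag (Fin.castLE ht i),
    fun i j h => x.off (Fin.castLE ht i) (Fin.castLE ht j) h⟩
  map_zero' := rfl
  map_one' := rfl
  map_add' _ _ := rfl
  map_mul' x y := by
    ext i j h
    · rfl
    · rw [mul_off]
      refine congrArg₂ (· + ·) rfl ?_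
      refine sum_castLE ht _ fun l hl => dif_neg fun hh => ?_
      exact absurd (Fin.lt_def.mp hh.2) (not_lt.mpr (j.isLt.le.trans hl))

/-- Extension of a leading principal submatrix by zero. -/
def extendZero {t : ℕ} {ht : t ≤ n} (y : (D.leading t ht).MatrixRing) : D.MatrixRing where
  diag i := if h : i < t then y.diag ⟨i, h⟩ else 0
  off i j hij := if h : j < t then y.off ⟨i, (Fin.lt_def.mp hij).trans h⟩ ⟨j, h⟩ hij else 0

section

variable {t : ℕ} {ht : t ≤ n}

theorem extendZero_diag_castLE (y : (D.leading t ht).MatrixRing) (i : Fin t) :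
    (extendZero y).diag (Fin.castLE ht i) = y.diag i := dif_pos i.isLt

theorem extendZero_off_castLE (y : (D.leading t ht).MatrixRing) {i j : Fin t} (h : i < j) :
    (extendZero y).off (Fin.castLE ht i) (Fin.castLE ht j) h = y.off i j h := dif_pos j.isLt

theorem extendZero_diag_of_le (y : (D.leading t ht).MatrixRing) {i : Fin n} (h : t ≤ i) :
    (extendZero y).diag i = 0 := dif_neg (not_lt.mpr h)

theorem extendZero_off_of_le (y : (D.leading t ht).MatrixRing) {i j : Fin n} (hij : i < j)
    (h : t ≤ j) : (extendZero y).off i j hij = 0 := dif_neg (not_lt.mpr h)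

theorem toLeading_extendZero (y : (D.leading t ht).MatrixRing) :
    D.toLeading t ht (extendZero y) = y := by
  ext i j h
  · exact extendZero_diag_castLE y i
  · exact extendZero_off_castLE y h

/-- Matrices whose columns with index at least `t` vanish are determined by their leading principal
`t × t` submatrix. -/
theorem ext_of_toLeading_eq {x y : D.MatrixRing} (h : D.toLeading t ht x = D.toLeading t ht y)
    (hx : ∀ i : Fin n, t ≤ i → x.diag i = 0) (hy : ∀ i : Fin n, t ≤ i → y.diag i = 0)
    (hx' : ∀ (i j : Fin n) (hij : i < j), t ≤ j → x.off i j hij = 0)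
    (hy' : ∀ (i j : Fin n) (hij : i < j), t ≤ j → y.off i j hij = 0) : x = y := by
  ext i j hij
  · by_cases hi : i < t
    · exact congrArg (fun z : (D.leading t ht).MatrixRing => z.diag ⟨i, hi⟩) h
    · rw [hx i (not_lt.mp hi), hy i (not_lt.mp hi)]
  · by_cases hj : j < t
    · exact congrArg (fun z : (D.leading t ht).MatrixRing =>
        z.off ⟨i, (Fin.lt_def.mp hij).trans hj⟩ ⟨j, hj⟩ hij) h
    · rw [hx' i j hij (not_lt.mp hj), hy' i j hij (not_lt.mp hj)]

/-- Extension by zero, as an additive map. -/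
def extendZeroHom (D : TriangularData.{u, v} n) (t : ℕ) (ht : t ≤ n) :
    (D.leading t ht).MatrixRing →+ D.MatrixRing where
  toFun := extendZero
  map_zero' := by
    refine ext_of_toLeading_eq (t := t) (ht := ht) ?_ (fun i h => extendZero_diag_of_le _ h)
      (fun _ _ => rfl) (fun i j hij h => extendZero_off_of_le _ hij h) fun _ _ _ _ => rfl
    rw [toLeading_extendZero, map_zero]
  map_add' x y := by
    refine ext_of_toLeading_eq (t := t) (ht := ht) ?_ (fun i h => extendZero_diag_of_le _ h)
      (fun i h => ?_) (fun i j hij h => extendZero_off_of_le _ hij h) fun i j hij h => ?_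
    · rw [map_add, toLeading_extendZero, toLeading_extendZero, toLeading_extendZero]
    · rw [add_diag, extendZero_diag_of_le _ h, extendZero_diag_of_le _ h, add_zero]
    · rw [add_off, extendZero_off_of_le _ hij h, extendZero_off_of_le _ hij h, add_zero]

theorem extendZero_toLeading_mul (a : D.MatrixRing) (y : (D.leading t ht).MatrixRing) :
    extendZero (D.toLeading t ht a * y) = a * extendZero y := by
  refine ext_of_toLeading_eq (t := t) (ht := ht) ?_ (fun i h => extendZero_diag_of_le _ h)
    (fun i h => ?_) (fun i j hij h => extendZero_off_of_le _ hij h) fun i j hij h => ?_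
  · rw [map_mul, toLeading_extendZero, toLeading_extendZero]
  · rw [mul_diag, extendZero_diag_of_le _ h, mul_zero]
  · rw [mul_off, extendZero_diag_of_le _ h, extendZero_off_of_le _ hij h, op_zero, zero_smul,
      smul_zero, zero_add, zero_add]
    refine Finset.sum_eq_zero fun l _ => ?_
    split_ifs with hl
    · rw [extendZero_off_of_le _ hl.2 h, map_zero]
    · rfl

end

/-- The part of the column of the matrix ring with index `t` that lies above the diagonal. -/
def upperColEquiv (D : TriangularData.{u, v} n) (t : ℕ) (ht : t < n) :
    D.peirce.upperCol ⟨t, ht⟩ ≃+ D.Column t ht where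
  toFun x := ⟨fun i => (x : D.MatrixRing).off (Fin.castLE ht.le i) ⟨t, ht⟩ i.isLt⟩
  map_add' _ _ := rfl
  invFun c := ⟨colMatrix ⟨t, ht⟩ 0 fun i => c.entry ⟨i.1, i.2⟩,
    colMatrix_mem _ _ _, Pi.single_eq_same (M := D.R) ⟨t, ht⟩ 0⟩
  left_inv x := by
    apply Subtype.ext
    have h1 := (mul_single_one_eq_iff _ _).mp x.2.1
    have h2 : (x : D.MatrixRing).diag ⟨t, ht⟩ = 0 := x.2.2
    rw [h2] at h1
    exact h1.symm
  right_inv c := by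
    ext i
    exact colMatrix_off_self ⟨t, ht⟩ 0 (fun i => c.entry ⟨i.1, i.2⟩)
      (i := Fin.castLE ht.le i) i.isLt

theorem upperColEquiv_smul (t : ℕ) (ht : t < n) (a : D.MatrixRing)
    (x : D.peirce.upperCol ⟨t, ht⟩) :
    D.upperColEquiv t ht (a • x) = D.toLeading t ht.le a • D.upperColEquiv t ht x := by
  have h2 : (x : D.MatrixRing).diag ⟨t, ht⟩ = 0 := x.2.2
  ext i
  rw [Column.smul_entry]
  change (a * (x : D.MatrixRing)).off (Fin.castLE ht.le i) ⟨t, ht⟩ i.isLt = _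
  rw [mul_off, h2, op_zero, zero_smul, add_zero]
  refine congrArg₂ (· + ·) rfl ?_
  refine (sum_castLE ht.le _ fun l hl => dif_neg fun hh => ?_).trans ?_
  · exact absurd (Fin.lt_def.mp hh.2) (not_lt.mpr hl)
  · refine Finset.sum_congr rfl fun l _ => ?_
    by_cases hl : i < l
    · rw [dif_pos hl]
      exact dif_pos ⟨hl, l.isLt⟩
    · rw [dif_neg hl]
      exact dif_neg fun hh => hl hh.1

/-- The column above the diagonal entry with index `t` is projective over the ring of leading
principal submatrices if and only if it is projective over the whole matrix ring. -/
theorem projective_upperCol_iff (D : TriangularData.{u, v} n) (t : ℕ) (ht : t < n) :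
    Module.Projective D.MatrixRing (D.peirce.upperCol ⟨t, ht⟩) ↔
      Module.Projective (D.leading t ht.le).MatrixRing (D.Column t ht) := by
  refine ⟨fun _ => ?_, fun _ => ?_⟩
  · exact Module.Projective.of_surjective_ringHom (D.toLeading t ht.le) (D.upperColEquiv t ht)
      (upperColEquiv_smul t ht) fun y => ⟨extendZero y, toLeading_extendZero y⟩
  · exact Module.Projective.of_ringHom_section (D.toLeading t ht.le) (D.upperColEquiv t ht)
      (upperColEquiv_smul t ht) (D.extendZeroHom t ht.le) toLeading_extendZero
      extendZero_toLeading_mul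

end Leading

end TriangularData

/-! ### Gorenstein conditions and the theorem -/

section Gorenstein

theorem baer_opposite {A : Type u} [Ring A] (h : IsQuasiFrobenius A) : Module.Baer Aᵐᵒᵖ Aᵐᵒᵖ :=
  (Module.Baer.of_injective h.injective_right).of_equiv (opSelfEquiv A)

theorem isNoetherian_opposite_iff (A : Type*) [Ring A] :
    IsNoetherian Aᵐᵒᵖ A ↔ IsNoetherian Aᵐᵒᵖ Aᵐᵒᵖ :=
  ⟨fun _ => isNoetherian_of_linearEquiv (opSelfEquiv A),
    fun _ => isNoetherian_of_linearEquiv (opSelfEquiv A).symm⟩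

theorem injectiveDimension_opposite (A : Type u) [Ring A] :
    injectiveDimension (ModuleCat.of Aᵐᵒᵖ A) = injectiveDimension (ModuleCat.of Aᵐᵒᵖ Aᵐᵒᵖ) :=
  injectiveDimension_eq_of_iso (opSelfEquiv A).toModuleIso

theorem injectiveDimension_ne_top_iff_injDimLT (A : Type u) [Ring A] :
    injectiveDimension (ModuleCat.of A A) ≠ ⊤ ↔ ∃ n, InjDimLT A n A := by
  rw [injectiveDimension_ne_top_iff]
  exact ⟨fun ⟨n, hn⟩ => ⟨n + 1, hn⟩, fun ⟨n, hn⟩ => ⟨n, hn.mono n.le_succ⟩⟩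

theorem isGorenstein_iff (A : Type u) [Ring A] : IsGorenstein A ↔
    (IsNoetherian A A ∧ ∃ n, InjDimLT A n A) ∧
      (IsNoetherian Aᵐᵒᵖ Aᵐᵒᵖ ∧ ∃ n, InjDimLT Aᵐᵒᵖ n Aᵐᵒᵖ) := by
  rw [← injectiveDimension_ne_top_iff_injDimLT, ← injectiveDimension_ne_top_iff_injDimLT,
    ← isNoetherian_opposite_iff, ← injectiveDimension_opposite]
  exact ⟨fun h => ⟨⟨h.1, h.3⟩, h.2, h.4⟩, fun h => ⟨h.1.1, h.2.1, h.1.2, h.2.2⟩⟩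

theorem isMGorenstein_one_iff (A : Type u) [Ring A] : IsMGorenstein 1 A ↔
    IsGorenstein A ∧ InjDimLT A 2 A ∧ InjDimLT Aᵐᵒᵖ 2 Aᵐᵒᵖ := by
  have h1 := injectiveDimension_le_iff (ModuleCat.of A A) 1
  have h2 := injectiveDimension_le_iff (ModuleCat.of Aᵐᵒᵖ Aᵐᵒᵖ) 1
  rw [← injectiveDimension_opposite] at h2
  exact ⟨fun h => ⟨h.toIsGorenstein, h1.mp h.2, h2.mp h.3⟩,
    fun h => ⟨h.1, h1.mpr h.2.1, h2.mpr h.2.2⟩⟩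

end Gorenstein

theorem proposition1p1 {n : ℕ} (hn : 2 ≤ n) (D : TriangularData.{u, v} n)
    (hR : ∀ i, IsQuasiFrobenius (D.R i)) :
    (IsGorenstein D.MatrixRing ↔ D.BimodulesFGProjective) ∧
    (IsMGorenstein 1 D.MatrixRing ↔
      D.BimodulesFGProjective ∧
        ∀ (t : ℕ) (_ : 1 ≤ t) (ht : t < n),
          Module.Projective (D.leading t ht.le).MatrixRing (D.Column t ht)) := by
  have hB : ∀ i, Module.Baer (D.R i) (D.R i) := fun i =>
    Module.Baer.of_injective (hR i).injective_left
  have hB' : ∀ i, Module.Baer (D.R i)ᵐᵒᵖ (D.R i)ᵐᵒᵖ := fun i => baer_opposite (hR i)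
  have hN : ∀ i, IsNoetherian (D.R i) (D.R i) := fun i => (hR i).noetherian_left
  have hN' : ∀ i, IsNoetherian (D.R i)ᵐᵒᵖ (D.R i)ᵐᵒᵖ := fun i =>
    (isNoetherian_opposite_iff _).mp (hR i).noetherian_right
  let S := D.peirce.oppositePair
  have hG : IsGorenstein D.MatrixRing ↔ D.BimodulesFGProjective := by
    rw [isGorenstein_iff, TriangularData.bimodulesFGProjective_iff]
    constructor
    · rintro ⟨⟨h1, h2⟩, h3, h4⟩
      exact ⟨TriangularPeirce.rowsFGProjective_of_injDimLT.{u, v} D.peirce h1 h2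
          fun i X _ _ _ =>
            exists_injective_of_finite (AntiEquiv.opposite (D.R i)) (hN i) (hN' i) (hB' i) X,
        TriangularPeirce.rowsFGProjective_of_injDimLT.{u, v} D.peirce.opposite h3 h4
          fun i X _ _ _ =>
            exists_injective_of_finite (AntiEquiv.opposite (D.R i)).symm (hN' i) (hN i) (hB i) X⟩
    · rintro ⟨h1, h2⟩
      exact ⟨⟨D.peirce.isNoetherian_self hN fun k => (h1 k).1, S.symm.exists_injDimLT hB h2 h1⟩,
        D.peirce.opposite.isNoetherian_self hN' fun k => (h2 k).1, S.exists_injDimLT hB' h1 h2⟩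
  refine ⟨hG, ?_⟩
  have hcol : (∀ (t : ℕ) (_ : 1 ≤ t) (ht : t < n),
      Module.Projective (D.leading t ht.le).MatrixRing (D.Column t ht)) ↔
      ∀ k, Module.Projective D.MatrixRing (D.peirce.upperCol k) := by
    constructor
    · rintro h ⟨t, ht⟩
      rw [TriangularData.projective_upperCol_iff]
      rcases t.eq_zero_or_pos with rfl | h0
      · -- the column above the first diagonal entry is empty
        have : Subsingleton (D.Column 0 ht) :=
          ⟨fun c d => TriangularData.Column.ext (funext fun i => i.elim0)⟩
        infer_instance
      · exact h t h0 ht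
    · exact fun h t _ ht => (D.projective_upperCol_iff t ht).mp (h ⟨t, ht⟩)
  rw [isMGorenstein_one_iff, hcol, hG]
  refine and_congr_right fun hD => ?_
  obtain ⟨h1, h2⟩ := D.bimodulesFGProjective_iff.mp hD
  constructor
  · rintro ⟨h, -⟩
    exact TriangularPeirce.projective_upperCol.{u, v} D.peirce
      (D.peirce.isNoetherian_self hN fun k => (h1 k).1) h1 h
  · intro h
    have hright := S.injDimLT_two hB' h2 h
    exact ⟨S.symm.injDimLT_two hB h1 (TriangularPeirce.projective_upperCol.{u, v}
      D.peirce.opposite (D.peirce.opposite.isNoetherian_self hN' fun k => (h2 k).1) h2 hright),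
      hright⟩
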